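/- **Notation.** Let $\zeta\in\mathbb C\cup\{\infty\}$ be the stereographic coordinate on $S^2$, $P=1+\zeta\bar\zeta$, and for a function $\eta(\zeta,\bar\zeta)$ of spin weight $s$ let $\eth\eta=P^{1-s}\,\partial_\zeta(P^s\eta)$. A spin-weighted function, possibly depending on a parameter, is *regular* if it is $C^\infty$ jointly in the parameter and the point of $S^2$, the point $\zeta=\infty$ included (in the frame of the chart $w=1/\zeta$). A subscript on $\eth$ names the variable held fixed, and a dot is $\partial/\partial u$. Lower indices with the Minkowski metric of signature $(+,-,-,-)$, extended bilinearly to complex Minkowski space $\mathbb C^4$, and let $$\hat l^a=\tfrac{\sqrt2}{2P}(1+\zeta\bar\zeta,\ \zeta+\bar\zeta,\ i\bar\zeta-i\zeta,\ -1+\zeta\bar\zeta),\qquad \hat m^a=\tfrac{\sqrt2}{2P}(0,\ 1-\bar\zeta^2,\ -i(1+\bar\zeta^2),\ 2\bar\zeta),$$ $$\hat n^a=\tfrac{\sqrt2}{2P}(1+\zeta\bar\zeta,\ -(\zeta+\bar\zeta),\ i\zeta-i\bar\zeta,\ 1-\zeta\bar\zeta),\qquad Y^0_0=1,\quad Y^0_{1i}=-(\hat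 l_i-\hat n_i)\ (i=1,2,3).$$ A stereographic angle field $L(u,\zeta,\bar\zeta)$ (spin weight $1$, $u$ real) defines the null geodesic congruence $$x^a=u(\hat l^a+\hat n^a)-L\,\overline{\hat m}{}^a-\bar L\,\hat m^a+(r-r_0)\hat l^a$$ in Minkowski space, with $r$ an affine parameter and $r_0(u,\zeta,\bar\zeta)$ an arbitrary smooth real function. With $l^a=\partial_r x^a$, the congruence is *shear-free* if $\nabla_{(a}l_{b)}m^am^b=0$ away from its caustics, for all complex $m^a$ with $m_am^a=m_al^a=0$, $m_a\bar m^a=-1$. Let $U\subset\mathbb R$ be open and non-empty (for instance $U=\mathbb R$) and $D\subset\mathbb C$ open. A *change of variables given by the CR equation of $L$* is a regular function $\tau=T(u,\zeta,\bar\zeta)$ of spin weight $0$ on $U\times S^2$ with values in $D$, satisfying $\eth_{(u)}T+L\dot T=0$, together with a regular cut function $u=G(\tau,\zeta,\bar\zeta)$ inverting it: $G$ has spin weight $0$, is regular on $D\times S^2$ and holomorphic in $\tau$, and $G(T(u,\zeta,\bar\zeta),\zeta,\bar\zeta)=u$. **Theorem.** 1. For a smooth $L$ on any open set of points $(u,\zeta)$,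 the congruence is shear-free if and only if $\eth_{(u)}L+L\dot L=0$. 2. Let $D$ be connected and $L$ regular on $U\times S^2$, with a change of variables $(T,G)$ given by its CR equation. Then, at $\tau=T(u,\zeta,\bar\zeta)$, $$L=\eth_{(\tau)}G,\qquad \eth_{(u)}L+L\dot L=\eth^2_{(\tau)}G .$$ The shear-free condition $\eth_{(u)}L+L\dot L=0$ on $U\times S^2$ is equivalent to the homogeneous good-cut equation $\eth^2_{(\tau)}G=0$ on $D\times S^2$. 3. The regular solutions on $S^2$ of $\eth^2 g=0$ (spin weight $0$) contain only $l=0,1$ harmonics: they are exactly the functions $$g=z^a\hat l_a=\tfrac{\sqrt2}{2}z^0Y^0_0-\tfrac12 z^iY^0_{1i},\qquad z\in\mathbb C^4,$$ and $z$ is unique. 4. If, in the situation of 2, the congruence of $L$ is shear-free, there is a holomorphic complex world line $\xi^a:D\to\mathbb C^4$ with $G(\tau,\zeta,\bar\zeta)=\xi^a(\tau)\hat l_a(\zeta,\bar\zeta)$ on $D\times S^2$. Hence the congruence is given parametrically by $$u=\xi^a(\tau)\,\hat l_a(\zeta,\bar\zeta),\qquad L(u,\zeta,\bar\zeta)=\xi^a(\tau)\,\hat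 m_a(\zeta,\bar\zeta),\qquad \tau=T(u,\zeta,\bar\zeta).$$ 5. The world line is arbitrary. Let $\xi^a$ be holomorphic on an open set $D\subset\mathbb C$. (a) If $u=\xi^a(\tau)\hat l_a$ is solved by a regular function $\tau=T(u,\zeta,\bar\zeta)$ on $U\times S^2$ with values in $D$, then $L=\xi^a(T)\hat m_a$ is regular on $U\times S^2$, $T$ and $G=\xi^a\hat l_a$ are a change of variables given by its CR equation, $\eth_{(u)}L+L\dot L=0$, and the congruence of $L$ is shear-free. (b) If $\tau_0\in D$, $\zeta_0\in\mathbb C$, $u_0=\xi^a(\tau_0)\hat l_a(\zeta_0,\bar\zeta_0)$ is real and $\xi^{a\prime}(\tau_0)\hat l_a(\zeta_0,\bar\zeta_0)\neq0$, then $u=\xi^a(\tau)\hat l_a$ has a smooth solution $\tau=T(u,\zeta,\bar\zeta)\in D$ near $(u_0,\zeta_0)$ with $T(u_0,\zeta_0,\bar\zeta_0)=\tau_0$, and $L=\xi^a(T)\hat m_a$ satisfies there the CR equation with $T$ and the shear-free condition. -/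

import Mathlib

open scoped ContDiff ComplexConjugate

noncomputable section

namespace ShearFree

/-! ### Stereographic coordinate, spin-weighted functions and the operator `ð`

A point of the sphere of null directions is labelled by the stereographic coordinate `ζ : ℂ`; the
remaining direction is `ζ = ∞`, reached through the coordinate `w = 1 / ζ`. A function of
`(ζ, ζ̄)` is a function `ℂ → ℂ` without any holomorphy. -/

/-- The conformal factor `P = 1 + ζ ζ̄` of the sphere metric `4 dζ dζ̄ / P²`. -/
def P (ζ : ℂ) : ℂ := 1 + ζ * conj ζ

/-- The Wirtinger derivative `∂f/∂ζ = (∂f/∂x - i ∂f/∂y) / 2`. -/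
def dZeta (f : ℂ → ℂ) (ζ : ℂ) : ℂ :=
  (fderiv ℝ f ζ 1 - Complex.I * fderiv ℝ f ζ Complex.I) / 2

/-- `ð η = P^(1-s) ∂(P^s η)/∂ζ` on a function `η` of spin weight `s`. -/
def eth (s : ℤ) (η : ℂ → ℂ) (ζ : ℂ) : ℂ :=
  P ζ ^ (1 - s) * dZeta (fun z => P z ^ s * η z) ζ

/-- `f`, a function of spin weight `s` on the sphere, is regular: it is smooth on the chart `ζ`, and
its component in the frame of the chart `w = 1/ζ` extends smoothly to `w = 0`, that is `ζ = ∞`.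
(The two frames differ by the phase `- w̄ / w`.) -/
def IsRegularOnSphere (s : ℤ) (f : ℂ → ℂ) : Prop :=
  ContDiff ℝ ∞ f ∧
    ∃ g : ℂ → ℂ, ContDiff ℝ ∞ g ∧ ∀ w : ℂ, w ≠ 0 → g w = (-conj w / w) ^ s * f w⁻¹

/-- A family `f a ζ`, `a ∈ A`, of functions of spin weight `s` is regular on `A × S²`: it is
jointly smooth in `(a, ζ)`, at `ζ = ∞` as well. -/
def IsRegularFamily {E : Type*} [NormedAddCommGroup E] [NormedSpace ℝ E]
    (s : ℤ) (A : Set E) (f : E → ℂ → ℂ) : Prop :=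
  ContDiffOn ℝ ∞ (fun p : E × ℂ => f p.1 p.2) (A ×ˢ Set.univ) ∧
    ∃ g : E × ℂ → ℂ, ContDiffOn ℝ ∞ g (A ×ˢ Set.univ) ∧
      ∀ a ∈ A, ∀ w : ℂ, w ≠ 0 → g (a, w) = (-conj w / w) ^ s * f a w⁻¹

/-! ### Minkowski space and the null tetrad -/

/-- The Minkowski product `v^a w_a`, signature `(+,-,-,-)`, extended complex bilinearly to complex
Minkowski space `ℂ⁴`. -/
def mink (v w : Fin 4 → ℂ) : ℂ := v 0 * w 0 - v 1 * w 1 - v 2 * w 2 - v 3 * w 3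

/-- `√2 / (2 (1 + ζ ζ̄))`. -/
def tetradScale (ζ : ℂ) : ℂ := (Real.sqrt 2 : ℂ) / (2 * P ζ)

/-- The null vector `l̂^a`. -/
def lHat (ζ : ℂ) : Fin 4 → ℂ :=
  tetradScale ζ • ![1 + ζ * conj ζ, ζ + conj ζ,
    Complex.I * conj ζ - Complex.I * ζ, -1 + ζ * conj ζ]

/-- The null vector `n̂^a`. -/
def nHat (ζ : ℂ) : Fin 4 → ℂ :=
  tetradScale ζ • ![1 + ζ * conj ζ, -(ζ + conj ζ),
    Complex.I * ζ - Complex.I * conj ζ, 1 - ζ * conj ζ]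

/-- The complex null vector `m̂^a`. -/
def mHat (ζ : ℂ) : Fin 4 → ℂ :=
  tetradScale ζ • ![0, 1 - conj ζ ^ 2, -(Complex.I * (1 + conj ζ ^ 2)), 2 * conj ζ]

/-- The complex conjugate of a vector. -/
def conjVec (v : Fin 4 → ℂ) : Fin 4 → ℂ := fun a => conj (v a)

/-- The `l = 0` harmonic `Y_0^0 = 1`. -/
def Y0 (_ζ : ℂ) : ℂ := 1

/-- The `l = 1` tensor harmonics `Y_{1i}^0 = -c_i = -(l_i - n_i)`, where `l_i`, `n_i` are the
spatial components (`i = 1, 2, 3`, here `i : Fin 3` for the component `i + 1`) of `l̂_a`, `n̂_a`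
with lowered index. -/
def Y1 (i : Fin 3) (ζ : ℂ) : ℂ := -((-lHat ζ i.succ) - (-nHat ζ i.succ))

/-! ### Null geodesic congruences in Minkowski space -/

/-- The null geodesic congruence with stereographic angle field `L(u, ζ)`: the ray labelled by the
point `(u, ζ)` of null infinity is
`x^a = u (l̂^a + n̂^a) - L m̂̄^a - L̄ m̂^a + (r - r₀) l̂^a`, with affine parameter `r`; the function
`r₀(u, ζ)` fixes the origin of `r`. A point `q` is `(u, ζ, r)`, the components `x^a` are real. -/
def ray (L : ℝ → ℂ → ℂ) (r₀ : ℝ → ℂ → ℝ) (q : ℝ × ℂ × ℝ) : Fin 4 → ℂ :=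
  (q.1 : ℂ) • (lHat q.2.1 + nHat q.2.1) - L q.1 q.2.1 • conjVec (mHat q.2.1)
    - conj (L q.1 q.2.1) • mHat q.2.1
    + ((q.2.2 - r₀ q.1 q.2.1 : ℝ) : ℂ) • lHat q.2.1

/-- The tangent field `l^a = ∂x^a/∂r` of a congruence `x^a = X^a(u, ζ, r)`. -/
def tangent (X : ℝ × ℂ × ℝ → Fin 4 → ℂ) (q : ℝ × ℂ × ℝ) : Fin 4 → ℂ :=
  fderiv ℝ X q (0, 0, 1)

/-- The shear `σ = ∇_(a l_b) m^a m^b` of the congruence `X` vanishes at the point `X q`, for every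
complex vector `m` with `m·m = m·l = 0` and `m·m̄ = -1`. The derivative of `l` along the complex
vector `m` is computed in the coordinates `(u, ζ, r)`, in which `m` is the complex tangent vector
`v + i w`. -/
def ShearVanishesAt (X : ℝ × ℂ × ℝ → Fin 4 → ℂ) (q : ℝ × ℂ × ℝ) : Prop :=
  ∀ (m : Fin 4 → ℂ) (v w : ℝ × ℂ × ℝ),
    mink m m = 0 → mink m (tangent X q) = 0 → mink m (conjVec m) = -1 →
    fderiv ℝ X q v + Complex.I • fderiv ℝ X q w = m →
    mink m (fderiv ℝ (tangent X) q v + Complex.I • fderiv ℝ (tangent X) q w) = 0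

/-- The rays of the congruence of `L` with labels `(u, ζ) ∈ O` are shear-free everywhere except at
the caustics, the points where the map `(u, ζ, r) ↦ x^a` is not a local coordinate system. -/
def IsShearFreeCongruence (O : Set (ℝ × ℂ)) (L : ℝ → ℂ → ℂ) (r₀ : ℝ → ℂ → ℝ) : Prop :=
  ∀ (u : ℝ) (ζ : ℂ) (r : ℝ), (u, ζ) ∈ O →
    Function.Injective (fderiv ℝ (ray L r₀) (u, ζ, r)) → ShearVanishesAt (ray L r₀) (u, ζ, r)

/-! ### The equations -/

/-- The left-hand side `ð_(u) L + L L̇` of the shear-free condition (`L` has spin weight one). -/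
def shearExpr (L : ℝ → ℂ → ℂ) (u : ℝ) (ζ : ℂ) : ℂ :=
  eth 1 (L u) ζ + L u ζ * deriv (fun v => L v ζ) u

/-- The shear-free condition `ð_(u) L + L L̇ = 0` at the points of `O`. -/
def ShearFreeCondition (O : Set (ℝ × ℂ)) (L : ℝ → ℂ → ℂ) : Prop :=
  ∀ (u : ℝ) (ζ : ℂ), (u, ζ) ∈ O → shearExpr L u ζ = 0

/-- The CR equation `ð_(u) T + L Ṫ = 0` at the points of `O` (`T` has spin weight zero). -/
def CREquation (O : Set (ℝ × ℂ)) (L T : ℝ → ℂ → ℂ) : Prop :=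
  ∀ (u : ℝ) (ζ : ℂ), (u, ζ) ∈ O → eth 0 (T u) ζ + L u ζ * deriv (fun v => T v ζ) u = 0

/-- The homogeneous good-cut equation `ð²_(τ) G = 0`, for all `τ ∈ D`. -/
def GoodCutEquation (D : Set ℂ) (G : ℂ → ℂ → ℂ) : Prop :=
  ∀ τ ∈ D, ∀ ζ : ℂ, eth 1 (eth 0 (G τ)) ζ = 0

/-- `τ = T(u, ζ)` is a regular complex variable on the part `U × S²` of null infinity, with values
in `D` (at `ζ = ∞` as well). -/
structure IsRegularVariable (U : Set ℝ) (D : Set ℂ) (T : ℝ → ℂ → ℂ) : Prop where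
  regular : IsRegularFamily 0 U T
  mem : ∀ u ∈ U, ∀ ζ : ℂ, T u ζ ∈ D
  mem_infty : ∀ u ∈ U, ∃ τ ∈ D, Filter.Tendsto (T u) (Filter.cocompact ℂ) (nhds τ)

/-- `G(τ, ζ)` is a regular cut function over `D`: regular on `D × S²` and holomorphic in `τ`. -/
structure IsRegularCutFunction (D : Set ℂ) (G : ℂ → ℂ → ℂ) : Prop where
  regular : IsRegularFamily 0 D G
  holomorphic : ∀ ζ : ℂ, DifferentiableOn ℂ (fun τ => G τ ζ) D

/-- The change of variables `τ = T(u, ζ)` given by the CR equation of `L`, with the regular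
inversion `u = G(τ, ζ)`. -/
structure IsCutChange (U : Set ℝ) (D : Set ℂ) (L T : ℝ → ℂ → ℂ) (G : ℂ → ℂ → ℂ) : Prop where
  variable_regular : IsRegularVariable U D T
  cr : CREquation (U ×ˢ Set.univ) L T
  cut_regular : IsRegularCutFunction D G
  inversion : ∀ u ∈ U, ∀ ζ : ℂ, G (T u ζ) ζ = u

end ShearFree

end

/-!
A ray of the congruence carries the coordinates `(u, ζ, r)`. In the null tetrad a complex coordinate
vector `a ∂_u + b P ∂_ζ + c P ∂_ζ̄` whose image is orthogonal to the ray has `a = b L + c L̄` and image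
`(b κ̄ - c σ̄) m̂ + (c κ - b σ) m̂̄` modulo `l̂`, with `σ = ðL + L L̇` and `κ` affine in `r`
(`divergenceExpr`, `rayM_add_I_mul`), while the tangent field changes by `b m̂ + c m̂̄`. For `σ = 0` the image is null only
if `b c = 0`, and then the shear vanishes; conversely, far out along the ray `|κ| > |σ|`, the coordinates
are regular, and the vector with image `m̂` has `c` proportional to `σ`. This proves
`isShearFreeCongruence_iff`.

Differentiating `G(T(u, ζ), ζ) = u` turns the CR equation into `L = ð_(τ) G` (`cr_iff_eq_eth`). The
operator `ð_(u) + L ∂_u` annihilates `T`, so it acts on a function of `(τ, ζ)` as `ð_(τ)`, provided that the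
function is holomorphic in `τ`; symmetry of second derivatives gives this for `ð_(τ) G`. Hence
`ðL + L L̇ = ð²G` (`shearExpr_eq_eth_eth`), and the identity theorem in `τ` extends the vanishing of `ð²G`
from a real curve to the whole domain.

A regular solution of `ð²g = 0` has `P² ∂g/∂ζ` antiholomorphic, and smoothness at `ζ = ∞` bounds it by
a multiple of `|ζ|²`: it is a quadratic polynomial in `ζ̄`, which is also produced by some `y^a l̂_a`. The
difference `g - y^a l̂_a` is antiholomorphic and bounded, so constant
(`IsRegularOnSphere.exists_eq_mink_lHat`). Since `z` is a linear function of four values of `z^a l̂_a`, the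
world line of a regular cut function inherits holomorphy from it.

For a given world line, `ð l̂ = m̂` and `ð m̂ = 0` say that `G = ξ^a l̂_a` solves the good-cut equation with
angle `ξ^a m̂_a`, and the relations above apply to it. The inversion `ζ ↦ 1/ζ` acts on the tetrad by a
half-turn of space, which gives regularity at `ζ = ∞`; local solutions come from the inverse function
theorem for `(τ, ζ) ↦ (G(τ, ζ), ζ)`.
-/

namespace ShearFree

/-! ### Calculus along real curves and Wirtinger derivatives -/

theorem contDiff_conj {n : WithTop ℕ∞} : ContDiff ℝ n (fun z : ℂ => conj z) :=
  Complex.conjCLE.contDiff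

theorem P_eq_ofReal (ζ : ℂ) : P ζ = ((1 + Complex.normSq ζ : ℝ) : ℂ) := by
  simp [P, Complex.mul_conj]

theorem P_ne_zero (ζ : ℂ) : P ζ ≠ 0 := by
  rw [P_eq_ofReal]
  have := Complex.normSq_nonneg ζ
  exact_mod_cast (by positivity : (1 + Complex.normSq ζ : ℝ) ≠ 0)

theorem conj_P (ζ : ℂ) : conj (P ζ) = P ζ := by
  rw [P_eq_ofReal, Complex.conj_ofReal]

theorem contDiff_P {n : WithTop ℕ∞} : ContDiff ℝ n P :=
  contDiff_const.add (contDiff_id.mul contDiff_conj)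

theorem sqrt_two_mul_self : (Real.sqrt 2 : ℂ) * (Real.sqrt 2 : ℂ) = 2 := by
  rw [← Complex.ofReal_mul, Real.mul_self_sqrt (by norm_num)]
  norm_num

theorem fderiv_apply_of_hasDerivAt_comp {E F : Type*} [NormedAddCommGroup E] [NormedSpace ℝ E]
    [NormedAddCommGroup F] [NormedSpace ℝ F] {f : E → F} {c : ℝ → E} {t : ℝ} {v : E} {d : F}
    (hf : DifferentiableAt ℝ f (c t)) (hc : HasDerivAt c v t)
    (hd : HasDerivAt (fun s => f (c s)) d t) : fderiv ℝ f (c t) v = d :=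
  (hf.hasFDerivAt.comp_hasDerivAt t hc).unique hd

theorem hasDerivAt_line {E : Type*} [NormedAddCommGroup E] [NormedSpace ℝ E] (x v : E) :
    HasDerivAt (fun t : ℝ => x + t • v) v 0 := by
  simpa using ((hasDerivAt_id (0 : ℝ)).smul_const v).const_add x

theorem hasDerivAt_conj_comp {c : ℝ → ℂ} {t : ℝ} {v : ℂ} (hc : HasDerivAt c v t) :
    HasDerivAt (fun s => conj (c s)) (conj v) t :=
  Complex.conjCLE.hasFDerivAt.comp_hasDerivAt t hc

theorem dZeta_eq {f : ℂ → ℂ} {f' : ℂ →L[ℝ] ℂ} {ζ : ℂ} (h : HasFDerivAt f f' ζ) :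
    dZeta f ζ = (f' 1 - Complex.I * f' Complex.I) / 2 := by
  rw [dZeta, h.fderiv]

/-- A real-linear derivative of the form `v ↦ a v + b v̄` has Wirtinger derivative `a`. -/
theorem dZeta_eq_of_forall {f : ℂ → ℂ} {ζ a b : ℂ}
    (h : ∀ v, fderiv ℝ f ζ v = a * v + b * conj v) : dZeta f ζ = a := by
  rw [dZeta, h, h]
  simp only [map_one, Complex.conj_I]
  linear_combination (-a / 2 + b / 2) * Complex.I_mul_I

theorem dZeta_sub {f g : ℂ → ℂ} {ζ : ℂ} (hf : DifferentiableAt ℝ f ζ)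
    (hg : DifferentiableAt ℝ g ζ) :
    dZeta (fun z => f z - g z) ζ = dZeta f ζ - dZeta g ζ := by
  rw [dZeta_eq (hf.hasFDerivAt.fun_sub hg.hasFDerivAt)]
  simp only [dZeta, sub_apply]
  ring

theorem dZeta_mul {f g : ℂ → ℂ} {ζ : ℂ} (hf : DifferentiableAt ℝ f ζ)
    (hg : DifferentiableAt ℝ g ζ) :
    dZeta (fun z => f z * g z) ζ = f ζ * dZeta g ζ + g ζ * dZeta f ζ := by
  rw [dZeta_eq (hf.hasFDerivAt.fun_mul hg.hasFDerivAt)]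
  simp only [dZeta, add_apply, smul_apply, smul_eq_mul]
  ring

/-- The Wirtinger derivative annihilates antiholomorphic functions. -/
theorem dZeta_comp_conj {k : ℂ → ℂ} {ζ : ℂ} (hk : DifferentiableAt ℂ k (conj ζ)) :
    dZeta (fun z => k (conj z)) ζ = 0 := by
  refine dZeta_eq_of_forall (b := deriv k (conj ζ)) fun v => ?_
  have h1 : HasFDerivAt k _ (conj ζ) := hk.hasDerivAt.hasFDerivAt.restrictScalars ℝ
  have h2 := h1.comp ζ Complex.conjCLE.hasFDerivAt
  rw [show (fun z => k (conj z)) = k ∘ conj from rfl, h2.fderiv]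
  simp [mul_comm]

/-- Chain rule for a holomorphic change of coordinate. -/
theorem dZeta_comp_holomorphic {f k : ℂ → ℂ} {ζ k' : ℂ} (hf : DifferentiableAt ℝ f (k ζ))
    (hk : HasDerivAt k k' ζ) : dZeta (fun z => f (k z)) ζ = k' * dZeta f (k ζ) := by
  have h1 : HasFDerivAt k _ ζ := hk.hasFDerivAt.restrictScalars ℝ
  rw [show (fun z => f (k z)) = f ∘ k from rfl, dZeta_eq (hf.hasFDerivAt.comp ζ h1)]
  have e : ∀ a : ℂ, fderiv ℝ f (k ζ) a
      = a.re * fderiv ℝ f (k ζ) 1 + a.im * fderiv ℝ f (k ζ) Complex.I := fun a => by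
    conv_lhs => rw [show a = a.re • (1 : ℂ) + a.im • Complex.I by simp]
    rw [map_add, map_smul, map_smul, Complex.real_smul, Complex.real_smul]
  simp only [ContinuousLinearMap.comp_apply, ContinuousLinearMap.coe_restrictScalars',
    ContinuousLinearMap.toSpanSingleton_apply, smul_eq_mul, one_mul, dZeta]
  rw [e k', e (Complex.I * k')]
  simp only [Complex.I_mul_re, Complex.I_mul_im, Complex.ofReal_neg]
  conv_rhs => rw [← Complex.re_add_im k']
  linear_combination ((k'.im : ℂ) * fderiv ℝ f (k ζ) Complex.I / 2) * Complex.I_mul_I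

/-- A real-differentiable function whose Wirtinger derivative vanishes is antiholomorphic. -/
theorem differentiableAt_comp_conj_of_dZeta_eq_zero {f : ℂ → ℂ} {ζ : ℂ}
    (hf : DifferentiableAt ℝ f (conj ζ)) (h : dZeta f (conj ζ) = 0) :
    DifferentiableAt ℂ (fun z => f (conj z)) ζ := by
  have h1 := hf.hasFDerivAt.comp ζ Complex.conjCLE.hasFDerivAt
  refine differentiableAt_complex_iff_differentiableAt_real.2 ⟨h1.differentiableAt, ?_⟩
  rw [show (fun z => f (conj z)) = f ∘ conj from rfl, h1.fderiv]
  simp only [dZeta] at h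
  simp
  linear_combination (-2) * Complex.I * h - fderiv ℝ f (conj ζ) Complex.I * Complex.I_mul_I

theorem eth_zero (η : ℂ → ℂ) (ζ : ℂ) : eth 0 η ζ = P ζ * dZeta η ζ := by
  simp [eth]

theorem eth_one (η : ℂ → ℂ) (ζ : ℂ) : eth 1 η ζ = dZeta (fun z => P z * η z) ζ := by
  simp [eth]

theorem hasDerivAt_P_comp {c : ℝ → ℂ} {t : ℝ} {v : ℂ} (hc : HasDerivAt c v t) :
    HasDerivAt (fun s => P (c s)) (v * conj (c t) + c t * conj v) t := by
  simpa [P] using (hc.mul (hasDerivAt_conj_comp hc)).const_add 1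

theorem dZeta_P (ζ : ℂ) : dZeta P ζ = conj ζ := by
  refine dZeta_eq_of_forall (b := ζ) fun v => ?_
  have h := hasDerivAt_line ζ v
  have := fderiv_apply_of_hasDerivAt_comp (f := P) (t := 0)
    (contDiff_P.differentiable (n := 1) (by norm_num)).differentiableAt h (hasDerivAt_P_comp h)
  simp only [zero_smul, add_zero] at this
  rw [this]
  ring

/-- `ð η = P ∂η/∂ζ + ζ̄ η` in spin weight one. -/
theorem eth_one_eq {η : ℂ → ℂ} {ζ : ℂ} (h : DifferentiableAt ℝ η ζ) :
    eth 1 η ζ = P ζ * dZeta η ζ + conj ζ * η ζ := by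
  rw [eth_one, dZeta_mul (contDiff_P.differentiable (n := 1) (by norm_num)).differentiableAt h,
    dZeta_P]
  ring

/-! ### The null tetrad -/

theorem conj_tetradScale (ζ : ℂ) : conj (tetradScale ζ) = tetradScale ζ := by
  simp [tetradScale, conj_P, Complex.conj_ofNat]

theorem tetradScale_mul_P (ζ : ℂ) : tetradScale ζ * (1 + ζ * conj ζ) = Real.sqrt 2 / 2 := by
  have hP := P_ne_zero ζ
  rw [← P, tetradScale]
  field_simp

theorem contDiff_tetradScale {n : WithTop ℕ∞} : ContDiff ℝ n tetradScale :=
  contDiff_const.mul <| (contDiff_const.mul contDiff_P).inv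
    fun ζ => mul_ne_zero two_ne_zero (P_ne_zero ζ)

theorem contDiff_lHat {n : WithTop ℕ∞} : ContDiff ℝ n lHat := by
  have hc := contDiff_conj (n := n)
  refine contDiff_tetradScale.smul (contDiff_pi.2 fun i => ?_)
  fin_cases i <;> simp <;> fun_prop

theorem contDiff_mHat {n : WithTop ℕ∞} : ContDiff ℝ n mHat := by
  have hc := contDiff_conj (n := n)
  refine contDiff_tetradScale.smul (contDiff_pi.2 fun i => ?_)
  fin_cases i <;> simp <;> fun_prop

theorem contDiff_conjVec {n : WithTop ℕ∞} : ContDiff ℝ n conjVec :=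
  contDiff_pi.2 fun i => contDiff_conj.comp (contDiff_apply ℝ ℂ i)

theorem hasDerivAt_tetradScale_comp {c : ℝ → ℂ} {t : ℝ} {v : ℂ} (hc : HasDerivAt c v t) :
    HasDerivAt (fun s => tetradScale (c s))
      (-(tetradScale (c t) * (v * conj (c t) + c t * conj v) / P (c t))) t := by
  have h := (hasDerivAt_const t (Real.sqrt 2 : ℂ)).div ((hasDerivAt_P_comp hc).const_mul 2)
    (mul_ne_zero two_ne_zero (P_ne_zero (c t)))
  refine h.congr_deriv ?_
  have := P_ne_zero (c t)
  simp only [tetradScale]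
  field_simp
  ring

/-- In terms of `ð`: `ð l̂ = m̂` and `ð̄ l̂ = m̂̄`. -/
theorem hasDerivAt_lHat_comp {c : ℝ → ℂ} {t : ℝ} {v : ℂ} (hc : HasDerivAt c v t) :
    HasDerivAt (fun s => lHat (c s))
      ((v / P (c t)) • mHat (c t) + (conj v / P (c t)) • conjVec (mHat (c t))) t := by
  have hs := hasDerivAt_tetradScale_comp hc
  have hc' := hasDerivAt_conj_comp hc
  have hP := P_ne_zero (c t)
  have hr := conj_tetradScale (c t)
  refine hasDerivAt_pi.2 fun i => ?_
  fin_cases i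
  · refine (hs.mul ((hc.mul hc').const_add 1)).congr_deriv ?_
    simp [mHat, conjVec]
    field_simp
    simp only [P]
    ring
  · refine (hs.mul (hc.add hc')).congr_deriv ?_
    simp [mHat, conjVec, hr]
    field_simp
    simp only [P]
    ring
  · refine (hs.mul ((hc'.const_mul Complex.I).sub (hc.const_mul Complex.I))).congr_deriv ?_
    simp [mHat, conjVec, hr]
    field_simp
    simp only [P]
    ring
  · refine (hs.mul ((hc.mul hc').const_add (-1))).congr_deriv ?_
    simp [mHat, conjVec, hr, Complex.conj_ofNat]
    field_simp
    simp only [P]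
    ring

/-- In terms of `ð`, for the spin weight one of `m̂`: `ð m̂ = 0` and `ð̄ m̂ = n̂ - l̂`. -/
theorem hasDerivAt_mHat_comp {c : ℝ → ℂ} {t : ℝ} {v : ℂ} (hc : HasDerivAt c v t) :
    HasDerivAt (fun s => mHat (c s))
      ((conj v / P (c t)) • (nHat (c t) - lHat (c t))
        + ((conj v * c t - conj (c t) * v) / P (c t)) • mHat (c t)) t := by
  have hs := hasDerivAt_tetradScale_comp hc
  have hc' := hasDerivAt_conj_comp hc
  have hc2 := hc'.pow 2
  have hP := P_ne_zero (c t)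
  refine hasDerivAt_pi.2 fun i => ?_
  fin_cases i
  · refine (hs.mul (hasDerivAt_const t (0 : ℂ))).congr_deriv ?_
    simp [mHat, nHat, lHat]
  · refine (hs.mul (hc2.const_sub 1)).congr_deriv ?_
    simp [mHat, nHat, lHat]
    field_simp
    simp only [P]
    ring
  · refine (hs.mul (((hc2.const_add 1).const_mul Complex.I).neg)).congr_deriv ?_
    simp [mHat, nHat, lHat]
    field_simp
    simp only [P]
    ring
  · refine (hs.mul (hc'.const_mul 2)).congr_deriv ?_
    simp [mHat, nHat, lHat]
    field_simp
    simp only [P]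
    ring

theorem mink_lHat (z : Fin 4 → ℂ) (ζ : ℂ) : mink z (lHat ζ) = tetradScale ζ *
    (z 0 * (1 + ζ * conj ζ) - z 1 * (ζ + conj ζ)
      - z 2 * (Complex.I * conj ζ - Complex.I * ζ) - z 3 * (-1 + ζ * conj ζ)) := by
  simp [mink, lHat]
  ring

theorem mink_mHat (z : Fin 4 → ℂ) (ζ : ℂ) : mink z (mHat ζ) = tetradScale ζ *
    (-z 1 * (1 - conj ζ ^ 2) + z 2 * (Complex.I * (1 + conj ζ ^ 2)) - z 3 * (2 * conj ζ)) := by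
  simp [mink, mHat]
  ring

/-- The vector `z`, with index lowered, as a complex-linear functional. -/
noncomputable def minkCLM (z : Fin 4 → ℂ) : (Fin 4 → ℂ) →L[ℂ] ℂ :=
  LinearMap.toContinuousLinearMap
    { toFun := fun w => mink z w
      map_add' := fun v w => by simp [mink]; ring
      map_smul' := fun a w => by simp [mink]; ring }

theorem minkCLM_apply (z w : Fin 4 → ℂ) : minkCLM z w = mink z w := rfl

theorem mink_comm (z w : Fin 4 → ℂ) : mink z w = mink w z := by
  simp [mink, mul_comm]

theorem contDiff_mink_lHat {n : WithTop ℕ∞} (z : Fin 4 → ℂ) :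
    ContDiff ℝ n (fun ζ => mink z (lHat ζ)) :=
  ((minkCLM z).restrictScalars ℝ).contDiff.comp contDiff_lHat

theorem eth_mink_lHat (z : Fin 4 → ℂ) (ζ : ℂ) :
    eth 0 (fun ζ => mink z (lHat ζ)) ζ = mink z (mHat ζ) := by
  have hP := P_ne_zero ζ
  rw [eth_zero, dZeta_eq_of_forall (a := mink z (mHat ζ) / P ζ)
    (b := mink z (conjVec (mHat ζ)) / P ζ)]
  · field_simp
  · intro v
    have h := hasDerivAt_line ζ v
    have := fderiv_apply_of_hasDerivAt_comp (t := 0)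
      ((contDiff_mink_lHat (n := 1) z).differentiable (by norm_num)).differentiableAt h
      (((minkCLM z).restrictScalars ℝ).hasFDerivAt.comp_hasDerivAt 0 (hasDerivAt_lHat_comp h))
    simp only [zero_smul, add_zero] at this
    rw [this]
    rw [ContinuousLinearMap.coe_restrictScalars', map_add, map_smul, map_smul]
    simp only [minkCLM_apply, smul_eq_mul]
    ring

theorem eth_mink_mHat (z : Fin 4 → ℂ) (ζ : ℂ) :
    eth 1 (fun ζ => mink z (mHat ζ)) ζ = 0 := by
  let k : ℂ → ℂ := fun w => (Real.sqrt 2 : ℂ) / 2 *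
    (-z 1 * (1 - w ^ 2) + z 2 * (Complex.I * (1 + w ^ 2)) - z 3 * (2 * w))
  have hk : Differentiable ℂ k := by fun_prop
  have h : (fun ζ => P ζ * mink z (mHat ζ)) = fun ζ => k (conj ζ) := by
    funext ζ
    have hP := P_ne_zero ζ
    rw [mink_mHat]
    simp only [tetradScale, k]
    field_simp
  rw [eth_one, h]
  exact dZeta_comp_conj hk.differentiableAt

/-! ### The shear of a null geodesic congruence -/

theorem conjVec_lHat (ζ : ℂ) : conjVec (lHat ζ) = lHat ζ := by
  have hr := conj_tetradScale ζ
  funext i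
  fin_cases i <;> simp [conjVec, lHat, hr] <;> ring_nf <;> simp

theorem conjVec_nHat (ζ : ℂ) : conjVec (nHat ζ) = nHat ζ := by
  have hr := conj_tetradScale ζ
  funext i
  fin_cases i <;> simp [conjVec, nHat, hr] <;> ring_nf <;> simp

theorem conjVec_mHat (ζ : ℂ) : conjVec (mHat ζ) =
    tetradScale ζ • ![0, 1 - ζ ^ 2, Complex.I * (1 + ζ ^ 2), 2 * ζ] := by
  have hr := conj_tetradScale ζ
  funext i
  fin_cases i <;> simp [conjVec, mHat, hr, Complex.conj_ofNat]

/-- The vector with components `a`, `b`, `c`, `d` along `n̂`, `m̂`, `m̂̄`, `l̂`. -/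
noncomputable def tetradVec (ζ a b c d : ℂ) : Fin 4 → ℂ :=
  a • nHat ζ + b • mHat ζ + c • conjVec (mHat ζ) + d • lHat ζ

theorem conjVec_tetradVec (ζ a b c d : ℂ) :
    conjVec (tetradVec ζ a b c d) = tetradVec ζ (conj a) (conj c) (conj b) (conj d) := by
  have hl := congrFun (conjVec_lHat ζ)
  have hn := congrFun (conjVec_nHat ζ)
  simp only [conjVec] at hl hn
  funext i
  simp [conjVec, tetradVec, hl, hn]
  ring

theorem mink_tetradVec (ζ a b c d a' b' c' d' : ℂ) :
    mink (tetradVec ζ a b c d) (tetradVec ζ a' b' c' d')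
      = a * d' + d * a' - b * c' - c * b' := by
  have hs : tetradScale ζ ^ 2 * (1 + ζ * conj ζ) ^ 2 = 1 / 2 := by
    rw [← mul_pow, tetradScale_mul_P]
    linear_combination (1 / 4) * sqrt_two_mul_self
  simp only [mink, tetradVec, conjVec_mHat]
  simp [lHat, nHat, mHat]
  generalize tetradScale ζ = s at *
  generalize conj ζ = η at *
  ring_nf
  simp only [Complex.I_sq]
  linear_combination (2 * a * d' + 2 * d * a' - 2 * b * c' - 2 * c * b') * hs

theorem lHat_add_nHat (ζ : ℂ) : lHat ζ + nHat ζ = ![(Real.sqrt 2 : ℂ), 0, 0, 0] := by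
  have h := tetradScale_mul_P ζ
  funext i
  fin_cases i <;> simp [lHat, nHat]
  · linear_combination 2 * h
  · ring
  · ring
  · ring

/-- The other Wirtinger derivative, `∂f/∂ζ̄`. -/
noncomputable def dZetaBar (f : ℂ → ℂ) (ζ : ℂ) : ℂ :=
  (fderiv ℝ f ζ 1 + Complex.I * fderiv ℝ f ζ Complex.I) / 2

theorem fderiv_eq_dZeta (f : ℂ → ℂ) (ζ v : ℂ) :
    fderiv ℝ f ζ v = v * dZeta f ζ + conj v * dZetaBar f ζ := by
  conv_lhs => rw [show v = v.re • (1 : ℂ) + v.im • Complex.I by simp]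
  rw [map_add, map_smul, map_smul, Complex.real_smul, Complex.real_smul, dZeta, dZetaBar]
  have h1 : v + conj v = 2 * v.re := by simp [Complex.add_conj]
  have h2 : v - conj v = 2 * v.im * Complex.I := by simp [Complex.sub_conj]
  linear_combination (-fderiv ℝ f ζ 1 / 2) * h1 +
    (Complex.I * fderiv ℝ f ζ Complex.I / 2) * h2
    + (v.im : ℂ) * fderiv ℝ f ζ Complex.I * Complex.I_mul_I

/-- The differential of a function on null infinity. -/
theorem fderiv_uncurry_apply {L : ℝ → ℂ → ℂ} {u : ℝ} {ζ : ℂ}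
    (hL : DifferentiableAt ℝ (fun p : ℝ × ℂ => L p.1 p.2) (u, ζ)) (a : ℝ) (b : ℂ) :
    fderiv ℝ (fun p : ℝ × ℂ => L p.1 p.2) (u, ζ) (a, b)
      = a * deriv (fun v => L v ζ) u + b * dZeta (L u) ζ + conj b * dZetaBar (L u) ζ := by
  have h1 : HasDerivAt (fun v => L v ζ) _ u :=
    HasFDerivAt.comp_hasDerivAt u (l := fun p : ℝ × ℂ => L p.1 p.2) hL.hasFDerivAt ((hasDerivAt_id u).prodMk (hasDerivAt_const u ζ))
  have h2 : HasFDerivAt (L u) _ ζ := hL.hasFDerivAt.comp ζ (hasFDerivAt_prodMk_right u ζ)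
  have h3 := fderiv_eq_dZeta (L u) ζ b
  rw [h2.fderiv] at h3
  rw [h1.deriv, add_assoc, ← h3, show ((a, b) : ℝ × ℂ) = a • (1, 0) + (0, b) by simp, map_add,
    map_smul, Complex.real_smul]
  rfl

section Ray

variable (L : ℝ → ℂ → ℂ) (r₀ : ℝ → ℂ → ℝ) (u : ℝ) (ζ : ℂ) (r : ℝ)

/-- The `n̂`-component of the image of the coordinate vector `v` under the congruence. -/
noncomputable def rayN (v : ℝ × ℂ × ℝ) : ℂ :=
  v.1 - (v.2.1 * L u ζ + conj v.2.1 * conj (L u ζ)) / P ζ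

/-- The `m̂̄`-component of the image of the coordinate vector `v` under the congruence. -/
noncomputable def rayM (v : ℝ × ℂ × ℝ) : ℂ :=
  -fderiv ℝ (fun p : ℝ × ℂ => L p.1 p.2) (u, ζ) (v.1, v.2.1)
    - L u ζ * (v.2.1 * conj ζ - conj v.2.1 * ζ) / P ζ + (r - r₀ u ζ) * (conj v.2.1 / P ζ)

/-- The `l̂`-component of the image of the coordinate vector `v` under the congruence. -/
noncomputable def rayL (v : ℝ × ℂ × ℝ) : ℂ :=
  v.1 + (v.2.1 * L u ζ + conj v.2.1 * conj (L u ζ)) / P ζ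
    + ((v.2.2 - fderiv ℝ (fun p : ℝ × ℂ => r₀ p.1 p.2) (u, ζ) (v.1, v.2.1) : ℝ) : ℂ)

variable {L r₀ u ζ}

theorem hasDerivAt_ray_line
    (hL : DifferentiableAt ℝ (fun p : ℝ × ℂ => L p.1 p.2) (u, ζ))
    (hr : DifferentiableAt ℝ (fun p : ℝ × ℂ => r₀ p.1 p.2) (u, ζ)) (v : ℝ × ℂ × ℝ) :
    HasDerivAt (fun t : ℝ => ray L r₀ ((u, ζ, r) + t • v))
      (tetradVec ζ (rayN L u ζ v) (conj (rayM L r₀ u ζ r v)) (rayM L r₀ u ζ r v)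
        (rayL L r₀ u ζ v)) 0 := by
  have hu : HasDerivAt (fun t : ℝ => u + t • v.1) v.1 0 := hasDerivAt_line u v.1
  have hz : HasDerivAt (fun t : ℝ => ζ + t • v.2.1) v.2.1 0 := hasDerivAt_line ζ v.2.1
  have hr' : HasDerivAt (fun t : ℝ => r + t • v.2.2) v.2.2 0 := hasDerivAt_line r v.2.2
  have h0 : (u + (0 : ℝ) • v.1, ζ + (0 : ℝ) • v.2.1) = (u, ζ) := by simp
  have hLc : HasDerivAt (fun t : ℝ => L (u + t • v.1) (ζ + t • v.2.1)) _ 0 :=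
    HasFDerivAt.comp_hasDerivAt (0 : ℝ) (l := fun p : ℝ × ℂ => L p.1 p.2)
      (by rw [h0]; exact hL.hasFDerivAt) (hu.prodMk hz)
  have hrc : HasDerivAt (fun t : ℝ => r₀ (u + t • v.1) (ζ + t • v.2.1)) _ 0 :=
    HasFDerivAt.comp_hasDerivAt (0 : ℝ) (l := fun p : ℝ × ℂ => r₀ p.1 p.2)
      (by rw [h0]; exact hr.hasFDerivAt) (hu.prodMk hz)
  have hl := hasDerivAt_lHat_comp hz
  have hm := hasDerivAt_mHat_comp hz
  have hmb := hasDerivAt_pi.2 fun i => hasDerivAt_conj_comp (hasDerivAt_pi.1 hm i)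
  have key := (((hu.ofReal_comp.smul_const ![(Real.sqrt 2 : ℂ), 0, 0, 0]).sub
    (hLc.smul hmb)).sub ((hasDerivAt_conj_comp hLc).smul hm)).add
    ((hr'.sub hrc).ofReal_comp.smul hl)
  refine (key.congr_of_eventuallyEq (Filter.Eventually.of_forall fun t => ?_)).congr_deriv ?_
  · simp only [ray, lHat_add_nHat, Prod.fst_add, Prod.snd_add, Prod.smul_fst, Prod.smul_snd]
    rfl
  have hl' := congrFun (conjVec_lHat ζ)
  have hn' := congrFun (conjVec_nHat ζ)
  simp only [conjVec] at hl' hn'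
  rw [← lHat_add_nHat ζ]
  funext i
  simp [tetradVec, rayN, rayM, rayL, conjVec, hl', hn', conj_P]
  ring

theorem differentiableAt_ray
    (hL : DifferentiableAt ℝ (fun p : ℝ × ℂ => L p.1 p.2) (u, ζ))
    (hr : DifferentiableAt ℝ (fun p : ℝ × ℂ => r₀ p.1 p.2) (u, ζ)) :
    DifferentiableAt ℝ (ray L r₀) (u, ζ, r) := by
  let pr : ℝ × ℂ × ℝ →L[ℝ] ℝ × ℂ :=
    (ContinuousLinearMap.fst ℝ ℝ (ℂ × ℝ)).prod
      ((ContinuousLinearMap.fst ℝ ℂ ℝ).comp (ContinuousLinearMap.snd ℝ ℝ (ℂ × ℝ)))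
  have hL' : DifferentiableAt ℝ (fun q : ℝ × ℂ × ℝ => L q.1 q.2.1) (u, ζ, r) :=
    DifferentiableAt.comp (g := fun p : ℝ × ℂ => L p.1 p.2) (u, ζ, r) hL
      pr.differentiableAt
  have hr' : DifferentiableAt ℝ (fun q : ℝ × ℂ × ℝ => r₀ q.1 q.2.1) (u, ζ, r) :=
    DifferentiableAt.comp (g := fun p : ℝ × ℂ => r₀ p.1 p.2) (u, ζ, r) hr
      pr.differentiableAt
  have hl : Differentiable ℝ lHat := contDiff_lHat.differentiable (n := 1) (by norm_num)
  have hm : Differentiable ℝ mHat := contDiff_mHat.differentiable (n := 1) (by norm_num)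
  have hc : Differentiable ℝ conjVec := contDiff_conjVec.differentiable (n := 1) (by norm_num)
  have hcc : Differentiable ℝ (fun z : ℂ => conj z) := Complex.differentiable_conj
  have hof : Differentiable ℝ Complex.ofReal := Complex.differentiable_ofReal
  unfold ray
  simp only [lHat_add_nHat]
  fun_prop

theorem fderiv_ray
    (hL : DifferentiableAt ℝ (fun p : ℝ × ℂ => L p.1 p.2) (u, ζ))
    (hr : DifferentiableAt ℝ (fun p : ℝ × ℂ => r₀ p.1 p.2) (u, ζ)) (v : ℝ × ℂ × ℝ) :
    fderiv ℝ (ray L r₀) (u, ζ, r) v =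
      tetradVec ζ (rayN L u ζ v) (conj (rayM L r₀ u ζ r v)) (rayM L r₀ u ζ r v)
        (rayL L r₀ u ζ v) := by
  have h := fderiv_apply_of_hasDerivAt_comp (t := 0) (f := ray L r₀)
    (by simpa using differentiableAt_ray r hL hr) (hasDerivAt_line (u, ζ, r) v)
    (hasDerivAt_ray_line r hL hr v)
  simpa using h

theorem tangent_ray
    (hL : DifferentiableAt ℝ (fun p : ℝ × ℂ => L p.1 p.2) (u, ζ))
    (hr : DifferentiableAt ℝ (fun p : ℝ × ℂ => r₀ p.1 p.2) (u, ζ)) :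
    tangent (ray L r₀) (u, ζ, r) = lHat ζ := by
  rw [tangent, fderiv_ray r hL hr]
  simp [tetradVec, rayN, rayM, rayL, show ((0 : ℝ), (0 : ℂ)) = 0 from rfl]

end Ray

section Ray

variable {L : ℝ → ℂ → ℂ} {r₀ : ℝ → ℂ → ℝ} {u : ℝ} {ζ : ℂ}

theorem tetradVec_add_I_smul (ζ a b c d a' b' c' d' : ℂ) :
    tetradVec ζ a b c d + Complex.I • tetradVec ζ a' b' c' d' = tetradVec ζ (a + Complex.I * a')
      (b + Complex.I * b') (c + Complex.I * c') (d + Complex.I * d') := by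
  simp only [tetradVec]
  module

/-- The tangent field of the congruence is parallel along each ray, and its derivative along
`b P ∂_ζ + c P ∂_ζ̄` is `b m̂ + c m̂̄`. -/
theorem fderiv_tangent_ray {O : Set (ℝ × ℂ)} (hO : IsOpen O)
    (hL : ContDiffOn ℝ ∞ (fun p : ℝ × ℂ => L p.1 p.2) O)
    (hr : ContDiffOn ℝ ∞ (fun p : ℝ × ℂ => r₀ p.1 p.2) O) (hp : (u, ζ) ∈ O) (r : ℝ)
    (v : ℝ × ℂ × ℝ) :
    fderiv ℝ (tangent (ray L r₀)) (u, ζ, r) v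
      = tetradVec ζ 0 (v.2.1 / P ζ) (conj v.2.1 / P ζ) 0 := by
  have hev : tangent (ray L r₀) =ᶠ[nhds (u, ζ, r)] fun q => lHat q.2.1 := by
    have hc : ContinuousAt (fun q : ℝ × ℂ × ℝ => (q.1, q.2.1)) (u, ζ, r) := by fun_prop
    filter_upwards [hc.preimage_mem_nhds (hO.mem_nhds hp)] with q hq
    exact tangent_ray (u := q.1) (ζ := q.2.1) q.2.2
      ((hL.contDiffAt (hO.mem_nhds hq)).differentiableAt (by simp))
      ((hr.contDiffAt (hO.mem_nhds hq)).differentiableAt (by simp))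
  rw [hev.fderiv_eq]
  have hl : Differentiable ℝ lHat := contDiff_lHat.differentiable (n := 1) (by norm_num)
  have h := fderiv_apply_of_hasDerivAt_comp (t := 0) (f := fun q : ℝ × ℂ × ℝ => lHat q.2.1)
    (by fun_prop) (hasDerivAt_line (u, ζ, r) v) (hasDerivAt_lHat_comp (hasDerivAt_line ζ v.2.1))
  simpa [tetradVec] using h

/-- The optical scalar `r - r₀ - ð̄L - L̄ L̇`, the diagonal entry of the matrix taking the
`ζ`-directions of the ray coordinates to the screen `m̂, m̂̄`; its off-diagonal entry is
`-(ðL + L L̇)`. -/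
noncomputable def divergenceExpr (L : ℝ → ℂ → ℂ) (r₀ : ℝ → ℂ → ℝ) (u : ℝ) (ζ : ℂ) (r : ℝ) : ℂ :=
  r - r₀ u ζ - P ζ * dZetaBar (L u) ζ + ζ * L u ζ - conj (L u ζ) * deriv (fun v => L v ζ) u

theorem shearExpr_eq (hL : DifferentiableAt ℝ (fun p : ℝ × ℂ => L p.1 p.2) (u, ζ)) :
    shearExpr L u ζ = P ζ * dZeta (L u) ζ + conj ζ * L u ζ
      + L u ζ * deriv (fun v => L v ζ) u := by
  have h2 : HasFDerivAt (L u) _ ζ := hL.hasFDerivAt.comp ζ (hasFDerivAt_prodMk_right u ζ)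
  rw [shearExpr, eth_one_eq h2.differentiableAt]

theorem rayN_add_I_mul (v w : ℝ × ℂ × ℝ) {a b c : ℂ} (ha : a = v.1 + Complex.I * w.1)
    (hb : b = (v.2.1 + Complex.I * w.2.1) / P ζ)
    (hc : c = (conj v.2.1 + Complex.I * conj w.2.1) / P ζ) :
    rayN L u ζ v + Complex.I * rayN L u ζ w = a - b * L u ζ - c * conj (L u ζ) := by
  rw [ha, hb, hc, rayN, rayN]
  ring

/-- For vectors orthogonal to the rays the screen components are given by the optical scalars. -/
theorem rayM_add_I_mul (hL : DifferentiableAt ℝ (fun p : ℝ × ℂ => L p.1 p.2) (u, ζ)) (r : ℝ)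
    (v w : ℝ × ℂ × ℝ) {a b c : ℂ} (ha : a = v.1 + Complex.I * w.1)
    (hb : b = (v.2.1 + Complex.I * w.2.1) / P ζ)
    (hc : c = (conj v.2.1 + Complex.I * conj w.2.1) / P ζ)
    (h : a - b * L u ζ - c * conj (L u ζ) = 0) :
    rayM L r₀ u ζ r v + Complex.I * rayM L r₀ u ζ r w
      = c * divergenceExpr L r₀ u ζ r - b * shearExpr L u ζ := by
  have hP := P_ne_zero ζ
  have hb' : v.2.1 + Complex.I * w.2.1 = b * P ζ := by rw [hb]; field_simp
  have hc' : conj v.2.1 + Complex.I * conj w.2.1 = c * P ζ := by rw [hc]; field_simp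
  rw [rayM, rayM, fderiv_uncurry_apply hL, fderiv_uncurry_apply hL, shearExpr_eq hL,
    divergenceExpr]
  generalize deriv (fun v => L v ζ) u = Ld at *
  generalize dZeta (L u) ζ = Lz at *
  generalize dZetaBar (L u) ζ = Lb at *
  generalize L u ζ = l at *
  have h1 : -(v.1 * Ld + v.2.1 * Lz + conj v.2.1 * Lb) - l * (v.2.1 * conj ζ - conj v.2.1 * ζ) / P ζ
        + (r - r₀ u ζ) * (conj v.2.1 / P ζ)
      + Complex.I * (-(w.1 * Ld + w.2.1 * Lz + conj w.2.1 * Lb)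
        - l * (w.2.1 * conj ζ - conj w.2.1 * ζ) / P ζ + (r - r₀ u ζ) * (conj w.2.1 / P ζ))
      = -((v.1 + Complex.I * w.1) * Ld + (v.2.1 + Complex.I * w.2.1) * Lz
          + (conj v.2.1 + Complex.I * conj w.2.1) * Lb)
        - l * (((v.2.1 + Complex.I * w.2.1) / P ζ) * conj ζ
          - ((conj v.2.1 + Complex.I * conj w.2.1) / P ζ) * ζ)
        + (r - r₀ u ζ) * ((conj v.2.1 + Complex.I * conj w.2.1) / P ζ) := by ring
  rw [h1, ← ha, ← hb, ← hc, hb', hc']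
  linear_combination (-Ld) * h

theorem conj_rayM_add_I_mul (hL : DifferentiableAt ℝ (fun p : ℝ × ℂ => L p.1 p.2) (u, ζ)) (r : ℝ)
    (v w : ℝ × ℂ × ℝ) {a b c : ℂ} (ha : a = v.1 + Complex.I * w.1)
    (hb : b = (v.2.1 + Complex.I * w.2.1) / P ζ)
    (hc : c = (conj v.2.1 + Complex.I * conj w.2.1) / P ζ)
    (h : a - b * L u ζ - c * conj (L u ζ) = 0) :
    conj (rayM L r₀ u ζ r v) + Complex.I * conj (rayM L r₀ u ζ r w)
      = b * conj (divergenceExpr L r₀ u ζ r) - c * conj (shearExpr L u ζ) := by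
  -- The conjugate of `v + i w` is `v + i (-w)`, with `b` and `c` exchanged and conjugated.
  have key := rayM_add_I_mul (r₀ := r₀) hL r v (-w) (a := conj a) (b := conj c) (c := conj b)
    (by simp [ha]) (by simp [hc, conj_P]) (by simp [hb, conj_P])
    (by
      have := congrArg conj h
      simp only [map_sub, map_mul, Complex.conj_conj, map_zero] at this
      linear_combination this)
  have hneg : rayM L r₀ u ζ r (-w) = -rayM L r₀ u ζ r w := by
    have : ((-w).1, (-w).2.1) = -(w.1, w.2.1) := rfl
    rw [rayM, rayM, this, map_neg]
    simp
    ring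
  have := congrArg conj key
  simpa [hneg] using this

theorem fderiv_ray_add_I_smul
    (hL : DifferentiableAt ℝ (fun p : ℝ × ℂ => L p.1 p.2) (u, ζ))
    (hr : DifferentiableAt ℝ (fun p : ℝ × ℂ => r₀ p.1 p.2) (u, ζ)) (r : ℝ) (v w : ℝ × ℂ × ℝ) :
    fderiv ℝ (ray L r₀) (u, ζ, r) v + Complex.I • fderiv ℝ (ray L r₀) (u, ζ, r) w =
      tetradVec ζ (rayN L u ζ v + Complex.I * rayN L u ζ w)
        (conj (rayM L r₀ u ζ r v) + Complex.I * conj (rayM L r₀ u ζ r w))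
        (rayM L r₀ u ζ r v + Complex.I * rayM L r₀ u ζ r w)
        (rayL L r₀ u ζ v + Complex.I * rayL L r₀ u ζ w) := by
  rw [fderiv_ray r hL hr, fderiv_ray r hL hr, tetradVec_add_I_smul]

theorem lHat_eq_tetradVec (ζ : ℂ) : lHat ζ = tetradVec ζ 0 0 0 1 := by
  simp [tetradVec]

/-- Where the divergence dominates the shear, the ray coordinates are regular. -/
theorem injective_fderiv_ray
    (hL : DifferentiableAt ℝ (fun p : ℝ × ℂ => L p.1 p.2) (u, ζ))
    (hr : DifferentiableAt ℝ (fun p : ℝ × ℂ => r₀ p.1 p.2) (u, ζ)) {r : ℝ}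
    (h : ‖shearExpr L u ζ‖ < ‖divergenceExpr L r₀ u ζ r‖) :
    Function.Injective (fderiv ℝ (ray L r₀) (u, ζ, r)) := by
  refine (injective_iff_map_eq_zero _).2 fun v hv => ?_
  rw [fderiv_ray r hL hr] at hv
  have hP := P_ne_zero ζ
  have prod := fun a' b' c' d' => mink_tetradVec ζ (rayN L u ζ v) (conj (rayM L r₀ u ζ r v))
    (rayM L r₀ u ζ r v) (rayL L r₀ u ζ v) a' b' c' d'
  have hmz : ∀ w : Fin 4 → ℂ, mink 0 w = 0 := fun w => by simp [mink]
  rw [hv] at prod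
  simp only [hmz] at prod
  have hN : rayN L u ζ v = 0 := by simpa using (prod 0 0 0 1).symm
  have hM : rayM L r₀ u ζ r v = 0 := by simpa using (prod 0 1 0 0).symm
  have hD : rayL L r₀ u ζ v = 0 := by simpa using (prod 1 0 0 0).symm
  have e := rayM_add_I_mul (r₀ := r₀) hL r v 0 (a := v.1) (b := v.2.1 / P ζ)
    (c := conj v.2.1 / P ζ) (by simp) (by simp) (by simp)
    (by rw [← hN, rayN]; ring)
  have h0 : rayM L r₀ u ζ r 0 = 0 := by
    simp [rayM, show ((0 : ℝ), (0 : ℂ)) = 0 from rfl]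
  rw [hM, h0, mul_zero, add_zero] at e
  have e2 : ‖conj v.2.1 / P ζ‖ * ‖divergenceExpr L r₀ u ζ r‖
      = ‖v.2.1 / P ζ‖ * ‖shearExpr L u ζ‖ := by
    rw [← norm_mul, ← norm_mul, sub_eq_zero.1 e.symm]
  rw [norm_div, norm_div, Complex.norm_conj] at e2
  have hz : v.2.1 = 0 := by
    by_contra hne
    have : 0 < ‖v.2.1‖ / ‖P ζ‖ := div_pos (norm_pos_iff.2 hne) (norm_pos_iff.2 hP)
    exact absurd e2 (mul_lt_mul_of_pos_left h this).ne'
  have h1 : v.1 = 0 := by simpa [rayN, hz] using hN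
  have h3 : v.2.2 = 0 := by
    simpa [rayL, hz, h1, show ((0 : ℝ), (0 : ℂ)) = 0 from rfl] using hD
  exact Prod.ext h1 (Prod.ext hz h3)

theorem shearVanishesAt_of_shearExpr_eq_zero {O : Set (ℝ × ℂ)} (hO : IsOpen O)
    (hL : ContDiffOn ℝ ∞ (fun p : ℝ × ℂ => L p.1 p.2) O)
    (hr : ContDiffOn ℝ ∞ (fun p : ℝ × ℂ => r₀ p.1 p.2) O) (hp : (u, ζ) ∈ O) (r : ℝ)
    (hσ : shearExpr L u ζ = 0) : ShearVanishesAt (ray L r₀) (u, ζ, r) := by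
  have hL' := (hL.contDiffAt (hO.mem_nhds hp)).differentiableAt (by simp)
  have hr' := (hr.contDiffAt (hO.mem_nhds hp)).differentiableAt (by simp)
  intro m v w hmm hml hmbar hm
  rw [tangent_ray r hL' hr', lHat_eq_tetradVec, ← hm, fderiv_ray_add_I_smul hL' hr',
    mink_tetradVec] at hml
  rw [← hm, fderiv_ray_add_I_smul hL' hr', mink_tetradVec] at hmm
  rw [← hm, fderiv_ray_add_I_smul hL' hr', conjVec_tetradVec, mink_tetradVec] at hmbar
  rw [fderiv_tangent_ray hO hL hr hp, fderiv_tangent_ray hO hL hr hp, ← hm,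
    fderiv_ray_add_I_smul hL' hr', tetradVec_add_I_smul, mink_tetradVec]
  have hN : rayN L u ζ v + Complex.I * rayN L u ζ w = 0 := by simpa using hml
  obtain ⟨a, ha⟩ : ∃ a : ℂ, a = v.1 + Complex.I * w.1 := ⟨_, rfl⟩
  obtain ⟨b, hb⟩ : ∃ b : ℂ, b = (v.2.1 + Complex.I * w.2.1) / P ζ := ⟨_, rfl⟩
  obtain ⟨c, hc⟩ : ∃ c : ℂ, c = (conj v.2.1 + Complex.I * conj w.2.1) / P ζ := ⟨_, rfl⟩
  have hab := (rayN_add_I_mul v w ha hb hc).symm.trans hN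
  have hM := rayM_add_I_mul (r₀ := r₀) hL' r v w ha hb hc hab
  have hMc := conj_rayM_add_I_mul (r₀ := r₀) hL' r v w ha hb hc hab
  rw [hσ] at hM hMc
  rw [hN, hM, hMc] at hmm hmbar
  rw [hN, hM, hMc]
  have eb : v.2.1 / P ζ + Complex.I * (w.2.1 / P ζ) = b := by rw [hb]; ring
  have ec : conj v.2.1 / P ζ + Complex.I * (conj w.2.1 / P ζ) = c := by rw [hc]; ring
  rw [eb, ec]
  generalize divergenceExpr L r₀ u ζ r = κ at *
  simp only [mul_zero, map_zero, sub_zero, zero_mul, zero_sub, add_zero,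
    map_mul, Complex.conj_conj] at hmm hmbar ⊢
  -- At a point with `κ = 0` the image of `v + i w` is along `l̂`, against `m·m̄ = -1`.
  have hκ : κ ≠ 0 := by
    rintro rfl
    simp at hmbar
  have hκ' : conj κ ≠ 0 := by simpa using hκ
  have hbc : (b * c) * (κ * conj κ) = 0 := by linear_combination (-1 / 2) * hmm
  rcases mul_eq_zero.1 ((mul_eq_zero.1 hbc).resolve_right (mul_ne_zero hκ hκ')) with h | h <;>
    simp [h]

theorem shearExpr_eq_zero_of_shearVanishesAt {O : Set (ℝ × ℂ)} (hO : IsOpen O)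
    (hL : ContDiffOn ℝ ∞ (fun p : ℝ × ℂ => L p.1 p.2) O)
    (hr : ContDiffOn ℝ ∞ (fun p : ℝ × ℂ => r₀ p.1 p.2) O) (hp : (u, ζ) ∈ O) {r : ℝ}
    (hκ : ‖shearExpr L u ζ‖ < ‖divergenceExpr L r₀ u ζ r‖)
    (h : ShearVanishesAt (ray L r₀) (u, ζ, r)) : shearExpr L u ζ = 0 := by
  have hL' := (hL.contDiffAt (hO.mem_nhds hp)).differentiableAt (by simp)
  have hr' := (hr.contDiffAt (hO.mem_nhds hp)).differentiableAt (by simp)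
  have hP := P_ne_zero ζ
  obtain ⟨κ, eκ⟩ : ∃ κ, κ = divergenceExpr L r₀ u ζ r := ⟨_, rfl⟩
  obtain ⟨σ, eσ⟩ : ∃ σ, σ = shearExpr L u ζ := ⟨_, rfl⟩
  rw [← eκ, ← eσ] at hκ
  have hdet : κ * conj κ - σ * conj σ ≠ 0 := by
    rw [Complex.mul_conj', Complex.mul_conj', sub_ne_zero]
    norm_cast
    exact (pow_lt_pow_left₀ hκ (norm_nonneg _) two_ne_zero).ne'
  obtain ⟨Δ, hΔ⟩ : ∃ Δ, Δ = κ * conj κ - σ * conj σ := ⟨_, rfl⟩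
  rw [← hΔ] at hdet
  -- The components `b`, `c` for which the screen part of the image is exactly `m̂`.
  let b : ℂ := κ / Δ
  let c : ℂ := σ / Δ
  let a : ℂ := b * L u ζ + c * conj (L u ζ)
  -- The real and imaginary part of the vector with components `a`, `b`, `c`.
  let v : ℝ × ℂ × ℝ := (a.re, (b * P ζ + conj (c * P ζ)) / 2, 0)
  let w : ℝ × ℂ × ℝ := (a.im, -Complex.I * (b * P ζ - conj (c * P ζ)) / 2, 0)
  have ha : a = v.1 + Complex.I * w.1 := by
    rw [mul_comm]
    exact (Complex.re_add_im a).symm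
  have hb : b = (v.2.1 + Complex.I * w.2.1) / P ζ := by
    rw [eq_div_iff hP]
    simp only [v, w]
    linear_combination ((b * P ζ - conj (c * P ζ)) / 2) * Complex.I_mul_I
  have hc : c = (conj v.2.1 + Complex.I * conj w.2.1) / P ζ := by
    rw [eq_div_iff hP]
    simp only [v, w, map_div₀, map_mul, map_add, map_sub, map_neg, Complex.conj_conj,
      Complex.conj_I, Complex.conj_ofNat, conj_P]
    linear_combination (-(conj b * P ζ - c * P ζ) / 2) * Complex.I_mul_I
  have hab : a - b * L u ζ - c * conj (L u ζ) = 0 := by simp only [a]; ring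
  have hN := (rayN_add_I_mul v w ha hb hc).trans hab
  have hM := rayM_add_I_mul (r₀ := r₀) hL' r v w ha hb hc hab
  have hMc := conj_rayM_add_I_mul (r₀ := r₀) hL' r v w ha hb hc hab
  rw [← eκ, ← eσ] at hM hMc
  have hM0 : c * κ - b * σ = 0 := by simp only [b, c]; ring
  have hM1 : b * conj κ - c * conj σ = 1 := by
    simp only [b, c]
    field_simp
    rw [hΔ]
  rw [hM0] at hM
  rw [hM1] at hMc
  have hm := fderiv_ray_add_I_smul hL' hr' r v w
  rw [hN, hM, hMc] at hm
  have key := h _ v w ?_ ?_ ?_ hm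
  · rw [fderiv_tangent_ray hO hL hr hp, fderiv_tangent_ray hO hL hr hp, tetradVec_add_I_smul,
      mink_tetradVec] at key
    have ec : conj v.2.1 / P ζ + Complex.I * (conj w.2.1 / P ζ) = c := by rw [hc]; ring
    rw [ec] at key
    have : c = 0 := by simpa using key
    simpa [c, hdet, eσ] using this
  · rw [mink_tetradVec]; ring
  · rw [tangent_ray r hL' hr', lHat_eq_tetradVec, mink_tetradVec]; ring
  · rw [conjVec_tetradVec, mink_tetradVec]; simp

theorem isShearFreeCongruence_iff {O : Set (ℝ × ℂ)} (hO : IsOpen O)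
    (hL : ContDiffOn ℝ ∞ (fun p : ℝ × ℂ => L p.1 p.2) O)
    (hr : ContDiffOn ℝ ∞ (fun p : ℝ × ℂ => r₀ p.1 p.2) O) :
    IsShearFreeCongruence O L r₀ ↔ ShearFreeCondition O L := by
  refine ⟨fun h u ζ hp => ?_, fun h u ζ r hp _ =>
    shearVanishesAt_of_shearExpr_eq_zero hO hL hr hp r (h u ζ hp)⟩
  have hL' := (hL.contDiffAt (hO.mem_nhds hp)).differentiableAt (by simp)
  have hr' := (hr.contDiffAt (hO.mem_nhds hp)).differentiableAt (by simp)
  -- Far enough along the ray the divergence exceeds the shear, which is constant along it.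
  obtain ⟨r, hlt⟩ : ∃ r : ℝ, ‖shearExpr L u ζ‖ < ‖divergenceExpr L r₀ u ζ r‖ := by
    refine ⟨‖shearExpr L u ζ‖ + 1 - (divergenceExpr L r₀ u ζ 0).re, ?_⟩
    refine lt_of_lt_of_le (lt_add_one _) (le_trans (le_of_eq ?_) (Complex.re_le_norm _))
    simp [divergenceExpr]
    ring
  exact shearExpr_eq_zero_of_shearVanishesAt hO hL hr hp hlt
    (h u ζ r hp (injective_fderiv_ray hL' hr' hlt))

end Ray

/-! ### Holomorphic families of functions on the sphere and the change of variables -/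

/-- A family `F τ ζ` that is jointly smooth on `D × ℂ` and holomorphic in the parameter `τ ∈ D`;
no condition is imposed at `ζ = ∞`. -/
structure IsHolomorphicFamily (D : Set ℂ) (F : ℂ → ℂ → ℂ) : Prop where
  smooth : ContDiffOn ℝ ∞ (fun p : ℂ × ℂ => F p.1 p.2) (D ×ˢ Set.univ)
  holomorphic : ∀ ζ : ℂ, DifferentiableOn ℂ (fun τ => F τ ζ) D

theorem IsRegularCutFunction.isHolomorphicFamily {D : Set ℂ} {G : ℂ → ℂ → ℂ}
    (h : IsRegularCutFunction D G) : IsHolomorphicFamily D G :=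
  ⟨h.regular.1, h.holomorphic⟩

namespace IsHolomorphicFamily

variable {D : Set ℂ} {F : ℂ → ℂ → ℂ}

theorem contDiffAt (hF : IsHolomorphicFamily D F) (hD : IsOpen D) {τ : ℂ} (hτ : τ ∈ D) (ζ : ℂ) :
    ContDiffAt ℝ ∞ (fun p : ℂ × ℂ => F p.1 p.2) (τ, ζ) :=
  hF.smooth.contDiffAt ((hD.prod isOpen_univ).mem_nhds ⟨hτ, trivial⟩)

theorem differentiableAt (hF : IsHolomorphicFamily D F) (hD : IsOpen D) {τ : ℂ} (hτ : τ ∈ D)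
    (ζ : ℂ) : DifferentiableAt ℝ (fun p : ℂ × ℂ => F p.1 p.2) (τ, ζ) :=
  (hF.contDiffAt hD hτ ζ).differentiableAt (by simp)

theorem fderiv_left (hF : IsHolomorphicFamily D F) (hD : IsOpen D) {τ : ℂ} (hτ : τ ∈ D) (ζ a : ℂ) :
    fderiv ℝ (fun p : ℂ × ℂ => F p.1 p.2) (τ, ζ) (a, 0) = deriv (fun τ => F τ ζ) τ * a := by
  have h1 : HasFDerivAt (fun τ => F τ ζ) _ τ :=
    HasFDerivAt.comp τ (g := fun p : ℂ × ℂ => F p.1 p.2) (f := fun τ => (τ, ζ))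
      (hF.differentiableAt hD hτ ζ).hasFDerivAt (hasFDerivAt_prodMk_left τ ζ)
  have h2 : HasFDerivAt (fun τ => F τ ζ) _ τ :=
    ((hF.holomorphic ζ).differentiableAt (hD.mem_nhds hτ)).hasDerivAt.hasFDerivAt.restrictScalars ℝ
  have := congrArg (fun l : ℂ →L[ℝ] ℂ => l a) (h1.unique h2)
  simpa [mul_comm] using this

theorem fderiv_right (hF : IsHolomorphicFamily D F) (hD : IsOpen D) {τ : ℂ} (hτ : τ ∈ D)
    (ζ b : ℂ) :
    fderiv ℝ (fun p : ℂ × ℂ => F p.1 p.2) (τ, ζ) (0, b) = fderiv ℝ (F τ) ζ b := by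
  have h1 : HasFDerivAt (F τ) _ ζ :=
    (hF.differentiableAt hD hτ ζ).hasFDerivAt.comp ζ (hasFDerivAt_prodMk_right τ ζ)
  rw [h1.fderiv]
  rfl

theorem mul_right (hF : IsHolomorphicFamily D F) {k : ℂ → ℂ} (hk : ContDiff ℝ ∞ k) :
    IsHolomorphicFamily D (fun τ ζ => k ζ * F τ ζ) :=
  ⟨(hk.comp contDiff_snd).contDiffOn.mul hF.smooth, fun ζ => (hF.holomorphic ζ).const_mul (k ζ)⟩

theorem contDiffOn_fderiv (hF : IsHolomorphicFamily D F) (hD : IsOpen D) :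
    ContDiffOn ℝ ∞ (fderiv ℝ (fun p : ℂ × ℂ => F p.1 p.2)) (D ×ˢ Set.univ) :=
  hF.smooth.fderiv_of_isOpen (hD.prod isOpen_univ) (by simp)

/-- Derivatives in the sphere directions stay holomorphic in the parameter, because mixed second
derivatives are symmetric. -/
theorem holomorphic_fderiv_right (hF : IsHolomorphicFamily D F) (hD : IsOpen D) {τ : ℂ}
    (hτ : τ ∈ D) (ζ e : ℂ) :
    DifferentiableAt ℂ
      (fun τ => fderiv ℝ (fun p : ℂ × ℂ => F p.1 p.2) (τ, ζ) (0, e)) τ := by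
  set Φ : ℂ × ℂ → ℂ := fun p => F p.1 p.2
  have hmem : D ×ˢ Set.univ ∈ nhds (τ, ζ) := (hD.prod isOpen_univ).mem_nhds ⟨hτ, trivial⟩
  have h2 : HasFDerivAt (fderiv ℝ Φ) (fderiv ℝ (fderiv ℝ Φ) (τ, ζ)) (τ, ζ) :=
    (((hF.contDiffOn_fderiv hD).contDiffAt hmem).differentiableAt (by simp)).hasFDerivAt
  have hsymm : IsSymmSndFDerivAt ℝ Φ (τ, ζ) :=
    (hF.contDiffAt hD hτ ζ).isSymmSndFDerivAt (by simpa using ENat.LEInfty.out)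
  have happ : ∀ w : ℂ × ℂ, HasFDerivAt (fun q => fderiv ℝ Φ q w)
      ((fderiv ℝ (fderiv ℝ Φ) (τ, ζ)).flip w) (τ, ζ) := fun w => by
    simpa using! h2.clm_apply (hasFDerivAt_const w (τ, ζ))
  have h3 : HasFDerivAt (fun τ => fderiv ℝ Φ (τ, ζ) (0, e)) _ τ :=
    HasFDerivAt.comp τ (g := fun q => fderiv ℝ Φ q (0, e)) (f := fun τ => (τ, ζ))
      (happ (0, e)) (hasFDerivAt_prodMk_left τ ζ)
  have hCR : (fun q => fderiv ℝ Φ q (Complex.I, 0))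
      =ᶠ[nhds (τ, ζ)] fun q => Complex.I * fderiv ℝ Φ q (1, 0) := by
    filter_upwards [hmem] with q hq
    have h1 := hF.fderiv_left hD hq.1 q.2 Complex.I
    have h2 := hF.fderiv_left hD hq.1 q.2 1
    change fderiv ℝ Φ q _ = _ at h1
    change fderiv ℝ Φ q _ = _ at h2
    rw [h1, h2]
    ring
  have h4 := congrArg (fun l : ℂ × ℂ →L[ℝ] ℂ => l (0, e))
    ((happ (Complex.I, 0)).unique (((happ (1, 0)).const_mul Complex.I).congr_of_eventuallyEq hCR))
  refine differentiableAt_complex_iff_differentiableAt_real.2 ⟨h3.differentiableAt, ?_⟩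
  rw [h3.fderiv]
  simp only [ContinuousLinearMap.flip_apply, smul_apply, smul_eq_mul] at h4
  simp only [ContinuousLinearMap.comp_apply, ContinuousLinearMap.flip_apply,
    ContinuousLinearMap.inl_apply, smul_eq_mul]
  rw [hsymm.eq, h4, hsymm.eq]

protected theorem dZeta (hF : IsHolomorphicFamily D F) (hD : IsOpen D) :
    IsHolomorphicFamily D (fun τ ζ => dZeta (F τ) ζ) := by
  have h : ∀ τ ∈ D, ∀ ζ : ℂ, dZeta (F τ) ζ
      = (fderiv ℝ (fun p : ℂ × ℂ => F p.1 p.2) (τ, ζ) (0, 1)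
        - Complex.I * fderiv ℝ (fun p : ℂ × ℂ => F p.1 p.2) (τ, ζ) (0, Complex.I)) / 2 :=
    fun τ hτ ζ => by rw [hF.fderiv_right hD hτ, hF.fderiv_right hD hτ, dZeta]
  constructor
  · have h' := hF.contDiffOn_fderiv hD
    refine ContDiffOn.congr (f := fun p : ℂ × ℂ =>
      (fderiv ℝ (fun p : ℂ × ℂ => F p.1 p.2) p (0, 1)
        - Complex.I * fderiv ℝ (fun p : ℂ × ℂ => F p.1 p.2) p (0, Complex.I)) / 2) ?_
      fun p hp => h p.1 hp.1 p.2
    exact ((h'.clm_apply contDiffOn_const).sub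
      (contDiffOn_const.mul (h'.clm_apply contDiffOn_const))).div_const 2
  · intro ζ τ hτ
    refine DifferentiableWithinAt.congr ?_ (fun τ hτ => h τ hτ ζ) (h τ hτ ζ)
    exact (((hF.holomorphic_fderiv_right hD hτ ζ 1).sub
      ((hF.holomorphic_fderiv_right hD hτ ζ Complex.I).const_mul Complex.I)).div_const
        2).differentiableWithinAt

theorem eth_zero (hF : IsHolomorphicFamily D F) (hD : IsOpen D) :
    IsHolomorphicFamily D (fun τ => eth 0 (F τ)) := by
  have : (fun τ => eth 0 (F τ)) = fun τ ζ => P ζ * ShearFree.dZeta (F τ) ζ := by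
    funext τ ζ
    exact ShearFree.eth_zero _ _
  rw [this]
  exact (hF.dZeta hD).mul_right contDiff_P

theorem eth_one (hF : IsHolomorphicFamily D F) (hD : IsOpen D) :
    IsHolomorphicFamily D (fun τ => eth 1 (F τ)) := by
  have : (fun τ => eth 1 (F τ)) = fun τ ζ => ShearFree.dZeta (fun z => P z * F τ z) ζ := by
    funext τ ζ
    exact ShearFree.eth_one _ _
  rw [this]
  exact (hF.mul_right contDiff_P).dZeta hD

/-- Chain rule: `∂_ζ` of a family evaluated along `τ = t(ζ)`. -/
theorem dZeta_comp (hF : IsHolomorphicFamily D F) (hD : IsOpen D) {t : ℂ → ℂ} {ζ : ℂ}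
    (ht : DifferentiableAt ℝ t ζ) (hτ : t ζ ∈ D) :
    ShearFree.dZeta (fun z => F (t z) z) ζ
      = deriv (fun τ => F τ ζ) (t ζ) * ShearFree.dZeta t ζ + ShearFree.dZeta (F (t ζ)) ζ := by
  have h : HasFDerivAt (fun z => F (t z) z) _ ζ :=
    HasFDerivAt.comp ζ (g := fun p : ℂ × ℂ => F p.1 p.2) (f := fun z => (t z, z))
      (hF.differentiableAt hD hτ ζ).hasFDerivAt (ht.hasFDerivAt.prodMk (hasFDerivAt_id ζ))
  have e : ∀ v : ℂ, fderiv ℝ (fun p : ℂ × ℂ => F p.1 p.2) (t ζ, ζ) (fderiv ℝ t ζ v, v)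
      = deriv (fun τ => F τ ζ) (t ζ) * fderiv ℝ t ζ v + fderiv ℝ (F (t ζ)) ζ v := fun v => by
    rw [← hF.fderiv_left hD hτ, ← hF.fderiv_right hD hτ, ← map_add]
    simp
  rw [dZeta_eq h]
  simp only [ContinuousLinearMap.comp_apply, ContinuousLinearMap.prod_apply,
    ContinuousLinearMap.id_apply]
  rw [e, e, ShearFree.dZeta, ShearFree.dZeta]
  ring

theorem hasDerivAt_comp (hF : IsHolomorphicFamily D F) (hD : IsOpen D) {t : ℝ → ℂ} {u : ℝ}
    (ζ : ℂ) (ht : DifferentiableAt ℝ t u) (hτ : t u ∈ D) :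
    HasDerivAt (fun v => F (t v) ζ) (deriv (fun τ => F τ ζ) (t u) * deriv t u) u := by
  have h : HasFDerivAt (fun τ => F τ ζ) _ (t u) :=
    ((hF.holomorphic ζ).differentiableAt (hD.mem_nhds hτ)).hasDerivAt.hasFDerivAt.restrictScalars ℝ
  refine (h.comp_hasDerivAt u ht.hasDerivAt).congr_deriv ?_
  simp [mul_comm]

end IsHolomorphicFamily

theorem _root_.Filter.EventuallyEq.dZeta_eq {f g : ℂ → ℂ} {ζ : ℂ} (h : f =ᶠ[nhds ζ] g) :
    dZeta f ζ = dZeta g ζ := by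
  rw [dZeta, dZeta, h.fderiv_eq]

section Slices

variable {O : Set (ℝ × ℂ)} {u : ℝ} {ζ : ℂ}

theorem eventually_slice_right (hO : IsOpen O) (hp : (u, ζ) ∈ O) :
    ∀ᶠ z in nhds ζ, (u, z) ∈ O :=
  (Continuous.prodMk_right u).continuousAt.preimage_mem_nhds (hO.mem_nhds hp)

theorem eventually_slice_left (hO : IsOpen O) (hp : (u, ζ) ∈ O) :
    ∀ᶠ v in nhds u, (v, ζ) ∈ O :=
  (Continuous.prodMk_left ζ).continuousAt.preimage_mem_nhds (hO.mem_nhds hp)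

theorem shearExpr_congr {L L' : ℝ → ℂ → ℂ} (hO : IsOpen O) (hp : (u, ζ) ∈ O)
    (h : ∀ (u : ℝ) (ζ : ℂ), (u, ζ) ∈ O → L u ζ = L' u ζ) :
    shearExpr L u ζ = shearExpr L' u ζ := by
  have h1 : L u =ᶠ[nhds ζ] L' u := (eventually_slice_right hO hp).mono fun z hz => h u z hz
  have h2 : (fun v => L v ζ) =ᶠ[nhds u] fun v => L' v ζ :=
    (eventually_slice_left hO hp).mono fun v hv => h v ζ hv
  rw [shearExpr, shearExpr, eth_one, eth_one, h2.deriv_eq, h u ζ hp]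
  congr 1
  exact Filter.EventuallyEq.dZeta_eq (h1.mono fun z hz => by simp only [hz])

variable {D : Set ℂ} {T : ℝ → ℂ → ℂ} {G : ℂ → ℂ → ℂ}

theorem differentiableAt_slice_right (hO : IsOpen O)
    (hT : ContDiffOn ℝ ∞ (fun p : ℝ × ℂ => T p.1 p.2) O) (hp : (u, ζ) ∈ O) :
    DifferentiableAt ℝ (T u) ζ :=
  (((hT.contDiffAt (hO.mem_nhds hp)).differentiableAt (by simp)).hasFDerivAt.comp ζ
    (hasFDerivAt_prodMk_right u ζ) : HasFDerivAt (T u) _ ζ).differentiableAt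

theorem differentiableAt_slice_left (hO : IsOpen O)
    (hT : ContDiffOn ℝ ∞ (fun p : ℝ × ℂ => T p.1 p.2) O) (hp : (u, ζ) ∈ O) :
    DifferentiableAt ℝ (fun v => T v ζ) u :=
  (HasFDerivAt.comp u (g := fun p : ℝ × ℂ => T p.1 p.2) (f := fun v => (v, ζ))
    ((hT.contDiffAt (hO.mem_nhds hp)).differentiableAt (by simp)).hasFDerivAt
    (hasFDerivAt_prodMk_left u ζ) : HasFDerivAt (fun v => T v ζ) _ u).differentiableAt

/-- Implicit differentiation of `G(T(u, ζ), ζ) = u`. -/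
theorem implicit_derivatives (hO : IsOpen O) (hD : IsOpen D) (hG : IsHolomorphicFamily D G)
    (hT : ContDiffOn ℝ ∞ (fun p : ℝ × ℂ => T p.1 p.2) O)
    (hTD : ∀ (u : ℝ) (ζ : ℂ), (u, ζ) ∈ O → T u ζ ∈ D)
    (hinv : ∀ (u : ℝ) (ζ : ℂ), (u, ζ) ∈ O → G (T u ζ) ζ = u) (hp : (u, ζ) ∈ O) :
    deriv (fun τ => G τ ζ) (T u ζ) * deriv (fun v => T v ζ) u = 1 ∧
      deriv (fun τ => G τ ζ) (T u ζ) * eth 0 (T u) ζ + eth 0 (G (T u ζ)) ζ = 0 := by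
  constructor
  · have h1 := hG.hasDerivAt_comp hD ζ (differentiableAt_slice_left hO hT hp) (hTD u ζ hp)
    have h2 : HasDerivAt (fun v : ℝ => (v : ℂ)) 1 u := Complex.ofRealCLM.hasDerivAt
    refine h1.unique (h2.congr_of_eventuallyEq ?_)
    exact (eventually_slice_left hO hp).mono fun v hv => hinv v ζ hv
  · have h1 := hG.dZeta_comp hD (differentiableAt_slice_right hO hT hp) (hTD u ζ hp)
    have h2 : (fun z => G (T u z) z) =ᶠ[nhds ζ] fun _ => (u : ℂ) :=
      (eventually_slice_right hO hp).mono fun z hz => hinv u z hz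
    have h3 : dZeta (fun _ => (u : ℂ)) ζ = 0 := by simp [dZeta]
    rw [h2.dZeta_eq, h3] at h1
    rw [eth_zero, eth_zero]
    linear_combination (-P ζ) * h1

/-- Under the inversion `u = G(τ, ζ)`, the CR equation says that `L` is the angle `ð_(τ) G`. -/
theorem cr_iff_eq_eth (hO : IsOpen O) (hD : IsOpen D) (hG : IsHolomorphicFamily D G)
    (hT : ContDiffOn ℝ ∞ (fun p : ℝ × ℂ => T p.1 p.2) O)
    (hTD : ∀ (u : ℝ) (ζ : ℂ), (u, ζ) ∈ O → T u ζ ∈ D)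
    (hinv : ∀ (u : ℝ) (ζ : ℂ), (u, ζ) ∈ O → G (T u ζ) ζ = u) (hp : (u, ζ) ∈ O) (l : ℂ) :
    eth 0 (T u) ζ + l * deriv (fun v => T v ζ) u = 0 ↔ l = eth 0 (G (T u ζ)) ζ := by
  obtain ⟨h1, h2⟩ := implicit_derivatives hO hD hG hT hTD hinv hp
  constructor
  · intro h
    linear_combination deriv (fun τ => G τ ζ) (T u ζ) * h - h2 - l * h1
  · rintro rfl
    linear_combination deriv (fun v => T v ζ) u * h2 - eth 0 (T u) ζ * h1

/-- Along the cuts, `ð_(u) + L ∂_u` acts as `ð_(τ)`, as it annihilates `τ`. -/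
theorem shearExpr_eq_eth_eth (hO : IsOpen O) (hD : IsOpen D) (hG : IsHolomorphicFamily D G)
    (hT : ContDiffOn ℝ ∞ (fun p : ℝ × ℂ => T p.1 p.2) O)
    (hTD : ∀ (u : ℝ) (ζ : ℂ), (u, ζ) ∈ O → T u ζ ∈ D) {L : ℝ → ℂ → ℂ}
    (hL : ∀ (u : ℝ) (ζ : ℂ), (u, ζ) ∈ O → L u ζ = eth 0 (G (T u ζ)) ζ)
    (hCR : CREquation O L T) (hp : (u, ζ) ∈ O) :
    shearExpr L u ζ = eth 1 (eth 0 (G (T u ζ))) ζ := by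
  rw [shearExpr_congr hO hp hL, shearExpr]
  have hE := hG.eth_zero hD
  have hTr := differentiableAt_slice_right hO hT hp
  have hTl := differentiableAt_slice_left hO hT hp
  have h0 := hCR u ζ hp
  rw [hL u ζ hp] at h0
  rw [(hE.hasDerivAt_comp hD ζ hTl (hTD u ζ hp)).deriv, eth_one, eth_one]
  have h1 := (hE.mul_right contDiff_P).dZeta_comp hD hTr (hTD u ζ hp)
  have hd : DifferentiableAt ℂ (fun τ => eth 0 (G τ) ζ) (T u ζ) :=
    (hE.holomorphic ζ).differentiableAt (hD.mem_nhds (hTD u ζ hp))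
  rw [h1, deriv_const_mul _ hd]
  rw [eth_zero (T u)] at h0
  linear_combination deriv (fun τ => eth 0 (G τ) ζ) (T u ζ) * h0

end Slices

section CutChange

variable {U : Set ℝ} {D : Set ℂ} {L T : ℝ → ℂ → ℂ} {G : ℂ → ℂ → ℂ}

theorem IsCutChange.eq_eth (h : IsCutChange U D L T G) (hU : IsOpen U) (hD : IsOpen D)
    {u : ℝ} (hu : u ∈ U) (ζ : ℂ) : L u ζ = eth 0 (G (T u ζ)) ζ :=
  (cr_iff_eq_eth (hU.prod isOpen_univ) hD h.cut_regular.isHolomorphicFamily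
    h.variable_regular.regular.1 (fun u ζ hp => h.variable_regular.mem u hp.1 ζ)
    (fun u ζ hp => h.inversion u hp.1 ζ) ⟨hu, trivial⟩ (L u ζ)).1 (h.cr u ζ ⟨hu, trivial⟩)

theorem IsCutChange.shearExpr_eq (h : IsCutChange U D L T G) (hU : IsOpen U) (hD : IsOpen D)
    {u : ℝ} (hu : u ∈ U) (ζ : ℂ) : shearExpr L u ζ = eth 1 (eth 0 (G (T u ζ))) ζ :=
  shearExpr_eq_eth_eth (hU.prod isOpen_univ) hD h.cut_regular.isHolomorphicFamily
    h.variable_regular.regular.1 (fun u ζ hp => h.variable_regular.mem u hp.1 ζ)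
    (fun _ ζ hp => h.eq_eth hU hD hp.1 ζ) h.cr ⟨hu, trivial⟩

/-- `ð²G` is holomorphic in `τ`, so that it vanishes on the connected domain `D` once it vanishes
along the real curve `u ↦ T(u, ζ)`, which is injective. -/
theorem IsCutChange.shearFreeCondition_iff (h : IsCutChange U D L T G) (hU : IsOpen U)
    (hne : U.Nonempty) (hD : IsOpen D) (hDc : IsConnected D) :
    ShearFreeCondition (U ×ˢ Set.univ) L ↔ GoodCutEquation D G := by
  constructor
  · intro hS τ hτ ζ
    obtain ⟨u, hu⟩ := hne
    have hHol := ((h.cut_regular.isHolomorphicFamily.eth_zero hD).eth_one hD).holomorphic ζ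
    have hcont : ContinuousAt (fun v => T v ζ) u :=
      (differentiableAt_slice_left (hU.prod isOpen_univ) h.variable_regular.regular.1
        (⟨hu, trivial⟩ : (u, ζ) ∈ U ×ˢ Set.univ)).continuousAt
    have hfreq : ∃ᶠ z in nhdsWithin (T u ζ) {T u ζ}ᶜ, eth 1 (eth 0 (G z)) ζ = 0 := by
      have ht : Filter.Tendsto (fun v => T v ζ) (nhdsWithin u {u}ᶜ)
          (nhdsWithin (T u ζ) {T u ζ}ᶜ) := by
        refine tendsto_nhdsWithin_of_tendsto_nhds_of_eventually_within _
          (hcont.tendsto.mono_left nhdsWithin_le_nhds) ?_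
        filter_upwards [self_mem_nhdsWithin, mem_nhdsWithin_of_mem_nhds (hU.mem_nhds hu)]
          with v hv hvU heq
        have e : T v ζ = T u ζ := heq
        have := h.inversion v hvU ζ
        rw [e, h.inversion u hu ζ] at this
        exact hv (by exact_mod_cast this.symm)
      refine ht.frequently (Filter.Eventually.frequently ?_)
      filter_upwards [mem_nhdsWithin_of_mem_nhds (hU.mem_nhds hu)] with v hvU
      rw [← h.shearExpr_eq hU hD hvU]
      exact hS v ζ ⟨hvU, trivial⟩
    exact (hHol.analyticOnNhd hD).eqOn_zero_of_preconnected_of_frequently_eq_zero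
      hDc.isPreconnected (h.variable_regular.mem u hu ζ) hfreq hτ
  · intro hG u ζ hp
    rw [h.shearExpr_eq hU hD hp.1]
    exact hG _ (h.variable_regular.mem u hp.1 ζ) ζ

end CutChange

/-! ### Regular solutions of the good-cut equation -/

/-- The spatial half-turn of complex Minkowski space that `ζ ↦ 1/ζ` induces on null directions. -/
noncomputable def inversionVec (z : Fin 4 → ℂ) : Fin 4 → ℂ := ![z 0, z 1, -z 2, -z 3]

theorem tetradScale_inv {w : ℂ} (hw : w ≠ 0) :
    tetradScale w⁻¹ = w * conj w * tetradScale w := by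
  have hP := P_ne_zero w
  have hw' : conj w ≠ 0 := by simpa using hw
  have h : P w⁻¹ = P w / (w * conj w) := by
    simp only [P, map_inv₀]
    field_simp
    ring
  rw [tetradScale, tetradScale, h]
  field_simp

theorem mink_lHat_inv (z : Fin 4 → ℂ) {w : ℂ} (hw : w ≠ 0) :
    mink z (lHat w⁻¹) = mink (inversionVec z) (lHat w) := by
  have hw' : conj w ≠ 0 := by simpa using hw
  rw [mink_lHat, mink_lHat, tetradScale_inv hw]
  simp [inversionVec]
  field_simp
  ring

/-- In the frame of the chart `w = 1/ζ` the components of `m̂` take the same form. -/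
theorem mink_mHat_inv (z : Fin 4 → ℂ) {w : ℂ} (hw : w ≠ 0) :
    -conj w / w * mink z (mHat w⁻¹) = mink (inversionVec z) (mHat w) := by
  have hw' : conj w ≠ 0 := by simpa using hw
  rw [mink_mHat, mink_mHat, tetradScale_inv hw]
  simp [inversionVec]
  field_simp
  ring

theorem isRegularOnSphere_mink_lHat (z : Fin 4 → ℂ) :
    IsRegularOnSphere 0 (fun ζ => mink z (lHat ζ)) :=
  ⟨contDiff_mink_lHat z, fun w => mink (inversionVec z) (lHat w), contDiff_mink_lHat _,
    fun w hw => by simp only [zpow_zero, one_mul, mink_lHat_inv z hw]⟩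

theorem mink_lHat_eq_harmonics (z : Fin 4 → ℂ) (ζ : ℂ) : mink z (lHat ζ) =
    (Real.sqrt 2 : ℂ) / 2 * z 0 * Y0 ζ - 1 / 2 * ∑ i : Fin 3, z i.succ * Y1 i ζ := by
  have h := tetradScale_mul_P ζ
  rw [mink_lHat]
  simp [Fin.sum_univ_three, Y0, Y1, lHat, nHat]
  linear_combination z 0 * h

/-- The vector `z` recovered from the values of `z^a l̂_a` at `ζ = 0, 1, -1, i`. -/
noncomputable def vecOfValues (g : ℂ → ℂ) : Fin 4 → ℂ :=
  ![(Real.sqrt 2 : ℂ) / 2 * (g 1 + g (-1)), (Real.sqrt 2 : ℂ) / 2 * (g (-1) - g 1),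
    (Real.sqrt 2 : ℂ) / 2 * (g 1 + g (-1) - 2 * g Complex.I),
    (Real.sqrt 2 : ℂ) / 2 * (2 * g 0 - g 1 - g (-1))]

theorem vecOfValues_mink_lHat (z : Fin 4 → ℂ) :
    vecOfValues (fun ζ => mink z (lHat ζ)) = z := by
  have hI := Complex.I_mul_I
  have h2 := sqrt_two_mul_self
  have e0 : mink z (lHat 0) = (Real.sqrt 2 : ℂ) / 2 * (z 0 + z 3) := by
    rw [mink_lHat]; simp [tetradScale, P]
  have e1 : mink z (lHat 1) = (Real.sqrt 2 : ℂ) / 2 * (z 0 - z 1) := by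
    rw [mink_lHat]; simp [tetradScale, P]; ring
  have e2 : mink z (lHat (-1)) = (Real.sqrt 2 : ℂ) / 2 * (z 0 + z 1) := by
    rw [mink_lHat]; simp [tetradScale, P]; ring
  have e3 : mink z (lHat Complex.I) = (Real.sqrt 2 : ℂ) / 2 * (z 0 - z 2) := by
    rw [mink_lHat]; simp [tetradScale, P]; ring
  funext i
  fin_cases i <;> simp only [vecOfValues, e0, e1, e2, e3]
  · simp; linear_combination z 0 / 2 * h2
  · simp; linear_combination z 1 / 2 * h2
  · simp; linear_combination z 2 / 2 * h2
  · simp; linear_combination z 3 / 2 * h2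

theorem IsRegularOnSphere.bounded {g : ℂ → ℂ} (hg : IsRegularOnSphere 0 g) :
    ∃ C, ∀ ζ, ‖g ζ‖ ≤ C := by
  obtain ⟨h1, k, hk, hkg⟩ := hg
  obtain ⟨C₁, hC₁⟩ := (isCompact_closedBall (0 : ℂ) 1).exists_bound_of_continuousOn
    h1.continuous.continuousOn
  obtain ⟨C₂, hC₂⟩ := (isCompact_closedBall (0 : ℂ) 1).exists_bound_of_continuousOn
    hk.continuous.continuousOn
  refine ⟨max C₁ C₂, fun ζ => ?_⟩
  rcases le_total ‖ζ‖ 1 with h | h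
  · exact (hC₁ ζ (by simpa using h)).trans (le_max_left _ _)
  · have hζ : ζ ≠ 0 := norm_pos_iff.1 (by linarith)
    have e := hkg ζ⁻¹ (inv_ne_zero hζ)
    rw [zpow_zero, one_mul, inv_inv] at e
    rw [← e]
    refine (hC₂ _ ?_).trans (le_max_right _ _)
    simpa using inv_le_one_of_one_le₀ h

theorem contDiff_dZeta {g : ℂ → ℂ} (hg : ContDiff ℝ ∞ g) : ContDiff ℝ ∞ (dZeta g) := by
  have h : ContDiff ℝ ∞ (fderiv ℝ g) := hg.fderiv_right (by simp)
  exact ((h.clm_apply contDiff_const).sub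
    (contDiff_const.mul (h.clm_apply contDiff_const))).div_const 2

theorem norm_P (ζ : ℂ) : ‖P ζ‖ = 1 + ‖ζ‖ ^ 2 := by
  rw [P_eq_ofReal, Complex.norm_real, Real.norm_of_nonneg
    (add_nonneg zero_le_one (Complex.normSq_nonneg ζ)), Complex.normSq_eq_norm_sq]

/-- Regularity at `ζ = ∞` bounds the growth of `P² ∂g/∂ζ` by that of a quadratic polynomial. -/
theorem IsRegularOnSphere.growth {g : ℂ → ℂ} (hg : IsRegularOnSphere 0 g) :
    ∃ C, ∀ ζ, 1 ≤ ‖ζ‖ → ‖P ζ * (P ζ * dZeta g ζ)‖ ≤ C * ‖ζ‖ ^ 2 := by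
  obtain ⟨h1, k, hk, hkg⟩ := hg
  obtain ⟨M, hM⟩ := (isCompact_closedBall (0 : ℂ) 1).exists_bound_of_continuousOn
    (contDiff_dZeta hk).continuous.continuousOn
  refine ⟨4 * M, fun ζ h => ?_⟩
  have hζ : ζ ≠ 0 := norm_pos_iff.1 (by linarith)
  have hw := inv_ne_zero hζ
  have e : dZeta k ζ⁻¹ = -ζ ^ 2 * dZeta g ζ := by
    have hev : k =ᶠ[nhds ζ⁻¹] fun w => g w⁻¹ := by
      filter_upwards [isOpen_ne.mem_nhds hw] with w hw
      rw [hkg w hw, zpow_zero, one_mul]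
    rw [hev.dZeta_eq, dZeta_comp_holomorphic
      (h1.differentiable (by simp)).differentiableAt (hasDerivAt_inv hw)]
    simp
  have hb := hM ζ⁻¹ (by simpa using inv_le_one_of_one_le₀ h)
  rw [e, norm_mul, norm_neg, norm_pow] at hb
  have hP : ‖P ζ‖ ≤ 2 * ‖ζ‖ ^ 2 := by
    rw [norm_P]
    nlinarith
  calc ‖P ζ * (P ζ * dZeta g ζ)‖ = ‖P ζ‖ * (‖P ζ‖ * ‖dZeta g ζ‖) := by
        rw [norm_mul, norm_mul]
    _ ≤ (2 * ‖ζ‖ ^ 2) * ((2 * ‖ζ‖ ^ 2) * ‖dZeta g ζ‖) := by gcongr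
    _ = 4 * (‖ζ‖ ^ 2 * ‖dZeta g ζ‖) * ‖ζ‖ ^ 2 := by ring
    _ ≤ 4 * M * ‖ζ‖ ^ 2 := by gcongr

/-- An entire function of quadratic growth is a quadratic polynomial. -/
theorem exists_quadratic_of_growth {H : ℂ → ℂ} (hH : Differentiable ℂ H) {C : ℝ}
    (hC : ∀ z, 1 ≤ ‖z‖ → ‖H z‖ ≤ C * ‖z‖ ^ 2) :
    ∃ a b c : ℂ, ∀ z, H z = a + b * z + c * z ^ 2 := by
  have hd : ∀ {f : ℂ → ℂ}, Differentiable ℂ f → Differentiable ℂ (dslope f 0) := fun hf =>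
    differentiableOn_univ.1
      ((Complex.differentiableOn_dslope Filter.univ_mem).2 hf.differentiableOn)
  have hs : ∀ (f : ℂ → ℂ) (z : ℂ), f z = f 0 + z * dslope f 0 z := fun f z => by
    have := sub_smul_dslope f 0 z
    rw [sub_zero, smul_eq_mul] at this
    rw [this]
    ring
  set f₁ := dslope H 0
  set f₂ := dslope f₁ 0
  have hf₂ : Differentiable ℂ f₂ := hd (hd hH)
  have hH2 : ∀ z, H z = H 0 + f₁ 0 * z + f₂ z * z ^ 2 := fun z => by
    rw [hs H z, show dslope H 0 z = f₁ z from rfl, hs f₁ z]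
    ring
  obtain ⟨M, hM⟩ := (isCompact_closedBall (0 : ℂ) 1).exists_bound_of_continuousOn
    hf₂.continuous.continuousOn
  have hbd : Bornology.IsBounded (Set.range f₂) := by
    refine (Metric.isBounded_iff_subset_closedBall 0).2
      ⟨max M (C + ‖H 0‖ + ‖f₁ 0‖), ?_⟩
    rintro _ ⟨z, rfl⟩
    rw [mem_closedBall_zero_iff]
    rcases le_total ‖z‖ 1 with h | h
    · exact (hM z (by simpa using h)).trans (le_max_left _ _)
    · refine le_trans ?_ (le_max_right _ _)
      have h0 : 0 < ‖z‖ ^ 2 := by positivity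
      refine le_of_mul_le_mul_right ?_ h0
      have e : f₂ z * z ^ 2 = H z - H 0 - f₁ 0 * z := by rw [hH2 z]; ring
      calc ‖f₂ z‖ * ‖z‖ ^ 2 = ‖H z - H 0 - f₁ 0 * z‖ := by rw [← e, norm_mul, norm_pow]
        _ ≤ ‖H z‖ + ‖H 0‖ + ‖f₁ 0‖ * ‖z‖ := by
          rw [← norm_mul]
          exact (norm_sub_le _ _).trans (by gcongr; exact norm_sub_le _ _)
        _ ≤ C * ‖z‖ ^ 2 + ‖H 0‖ * ‖z‖ ^ 2 + ‖f₁ 0‖ * ‖z‖ ^ 2 := by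
          gcongr
          · exact hC z h
          · exact le_mul_of_one_le_right (norm_nonneg _) (one_le_pow₀ h)
          · exact le_self_pow₀ h two_ne_zero
        _ = (C + ‖H 0‖ + ‖f₁ 0‖) * ‖z‖ ^ 2 := by ring
  exact ⟨H 0, f₁ 0, f₂ 0, fun z => by
    rw [hH2 z, hf₂.apply_eq_apply_of_bounded hbd z 0]⟩

/-- A bounded function annihilated by `∂_ζ` is constant. -/
theorem eq_of_dZeta_eq_zero_of_bounded {d : ℂ → ℂ} (hd : Differentiable ℝ d)
    (h0 : ∀ ζ, dZeta d ζ = 0) {C : ℝ} (hC : ∀ ζ, ‖d ζ‖ ≤ C) (ζ : ℂ) : d ζ = d 0 := by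
  have hent : Differentiable ℂ (fun z => d (conj z)) := fun z =>
    differentiableAt_comp_conj_of_dZeta_eq_zero hd.differentiableAt (h0 _)
  have hbd : Bornology.IsBounded (Set.range fun z => d (conj z)) := by
    refine (Metric.isBounded_iff_subset_closedBall 0).2 ⟨C, ?_⟩
    rintro _ ⟨z, rfl⟩
    simpa using hC _
  simpa using hent.apply_eq_apply_of_bounded hbd (conj ζ) 0

theorem IsRegularOnSphere.exists_eq_mink_lHat {g : ℂ → ℂ} (hg : IsRegularOnSphere 0 g)
    (h : ∀ ζ, eth 1 (eth 0 g) ζ = 0) : ∃ z : Fin 4 → ℂ, ∀ ζ, g ζ = mink z (lHat ζ) := by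
  have hgd : Differentiable ℝ g := hg.1.differentiable (by simp)
  have hf : Differentiable ℝ (fun ζ => P ζ * (P ζ * dZeta g ζ)) :=
    (contDiff_P.mul (contDiff_P.mul (contDiff_dZeta hg.1))).differentiable (by simp)
  have hf0 : ∀ ζ, dZeta (fun ζ => P ζ * (P ζ * dZeta g ζ)) ζ = 0 := fun ζ => by
    have := h ζ
    rw [eth_one] at this
    simpa only [eth_zero] using this
  obtain ⟨C, hC⟩ := hg.growth
  obtain ⟨a, b, c, habc⟩ := exists_quadratic_of_growth
    (H := fun z => P (conj z) * (P (conj z) * dZeta g (conj z))) (C := C)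
    (fun z => differentiableAt_comp_conj_of_dZeta_eq_zero hf.differentiableAt (hf0 _))
    (fun z hz => by simpa using hC (conj z) (by simpa using hz))
  -- `y` solves `P ð(y^a l̂_a) = a + b ζ̄ + c ζ̄²`.
  let y : Fin 4 → ℂ := ![0, Real.sqrt 2 * (c - a) / 2, -Complex.I * Real.sqrt 2 * (a + c) / 2,
    -Real.sqrt 2 * b / 2]
  have hy : ∀ ζ, P ζ * mink y (mHat ζ) = a + b * conj ζ + c * conj ζ ^ 2 := fun ζ => by
    have hs : P ζ * tetradScale ζ = Real.sqrt 2 / 2 := by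
      rw [mul_comm, P, tetradScale_mul_P]
    have h2 := sqrt_two_mul_self
    rw [mink_mHat, ← mul_assoc, hs]
    simp [y]
    linear_combination ((a + c) / 4 * (1 + conj ζ ^ 2) - (c - a) / 4 * (1 - conj ζ ^ 2)
      + b / 2 * conj ζ) * h2
      - (Real.sqrt 2 : ℂ) * Real.sqrt 2 / 4 * (a + c) * (1 + conj ζ ^ 2) * Complex.I_mul_I
  have hyd : Differentiable ℝ (fun ζ => mink y (lHat ζ)) :=
    (contDiff_mink_lHat (n := 1) y).differentiable (by norm_num)
  obtain ⟨C₁, hC₁⟩ := hg.bounded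
  obtain ⟨C₂, hC₂⟩ := (isRegularOnSphere_mink_lHat y).bounded
  have hconst := eq_of_dZeta_eq_zero_of_bounded (hgd.sub hyd) (C := C₁ + C₂)
    (fun ζ => by
      have hP := P_ne_zero ζ
      have e1 := habc (conj ζ)
      have e2 := eth_mink_lHat y ζ
      rw [eth_zero] at e2
      have e3 := hy ζ
      simp only [Complex.conj_conj] at e1
      rw [← e1, ← e2] at e3
      have e4 := mul_left_cancel₀ hP (mul_left_cancel₀ hP e3)
      exact (dZeta_sub hgd.differentiableAt hyd.differentiableAt).trans
        (by rw [e4, sub_self]))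
    (fun ζ => (norm_sub_le _ _).trans (add_le_add (hC₁ ζ) (hC₂ ζ)))
  set d := g 0 - mink y (lHat 0)
  refine ⟨![Real.sqrt 2 * d, y 1, y 2, y 3], fun ζ => ?_⟩
  have hs := tetradScale_mul_P ζ
  have hd : g ζ - mink y (lHat ζ) = d := hconst ζ
  rw [mink_lHat] at hd ⊢
  have hy0 : y 0 = 0 := rfl
  simp only [hy0] at hd
  simp
  linear_combination hd - Real.sqrt 2 * d * hs - d / 2 * sqrt_two_mul_self

/-- The kernel of `ð²` on regular functions is the four-dimensional space of the `z^a l̂_a`. -/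
theorem regular_goodCut_iff_existsUnique (g : ℂ → ℂ) :
    (IsRegularOnSphere 0 g ∧ ∀ ζ : ℂ, eth 1 (eth 0 g) ζ = 0) ↔
      ∃! z : Fin 4 → ℂ, ∀ ζ : ℂ, g ζ = mink z (lHat ζ) := by
  constructor
  · rintro ⟨hg, h⟩
    obtain ⟨z, hz⟩ := hg.exists_eq_mink_lHat h
    refine ⟨z, hz, fun z' hz' => ?_⟩
    rw [← vecOfValues_mink_lHat z, ← vecOfValues_mink_lHat z', ← funext hz, ← funext hz']
  · rintro ⟨z, hz, -⟩
    obtain rfl : g = fun ζ => mink z (lHat ζ) := funext hz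
    refine ⟨isRegularOnSphere_mink_lHat z, fun ζ => ?_⟩
    rw [funext (eth_mink_lHat z)]
    exact eth_mink_mHat z ζ

/-! ### Complex world lines -/

theorem contDiffOn_mink {E : Type*} [NormedAddCommGroup E] [NormedSpace ℝ E] {s : Set E}
    {f g : E → Fin 4 → ℂ} (hf : ContDiffOn ℝ ∞ f s) (hg : ContDiffOn ℝ ∞ g s) :
    ContDiffOn ℝ ∞ (fun x => mink (f x) (g x)) s := by
  have hf' := contDiffOn_pi.1 hf
  have hg' := contDiffOn_pi.1 hg
  exact ((((hf' 0).mul (hg' 0)).sub ((hf' 1).mul (hg' 1))).sub ((hf' 2).mul (hg' 2))).sub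
    ((hf' 3).mul (hg' 3))

theorem contDiff_inversionVec : ContDiff ℝ ∞ inversionVec := by
  refine contDiff_pi.2 fun i => ?_
  fin_cases i <;> simp [inversionVec] <;> fun_prop

section WorldLine

variable {D : Set ℂ} {ξ : ℂ → Fin 4 → ℂ}

theorem contDiffOn_real_of_holomorphic (hD : IsOpen D) (hξ : DifferentiableOn ℂ ξ D) :
    ContDiffOn ℝ ∞ ξ D :=
  (hξ.contDiffOn hD).restrict_scalars ℝ

theorem hasDerivAt_mink_worldLine (hD : IsOpen D) (hξ : DifferentiableOn ℂ ξ D) {τ : ℂ}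
    (hτ : τ ∈ D) (y : Fin 4 → ℂ) :
    HasDerivAt (fun τ => mink (ξ τ) y) (mink (deriv ξ τ) y) τ := by
  have h := (minkCLM y).hasFDerivAt.comp_hasDerivAt τ
    (hξ.differentiableAt (hD.mem_nhds hτ)).hasDerivAt
  rw [minkCLM_apply, mink_comm] at h
  refine h.congr_of_eventuallyEq (Filter.Eventually.of_forall fun τ => ?_)
  exact mink_comm _ _

theorem isRegularCutFunction_worldLine (hD : IsOpen D) (hξ : DifferentiableOn ℂ ξ D) :
    IsRegularCutFunction D (fun τ ζ => mink (ξ τ) (lHat ζ)) := by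
  have h : ContDiffOn ℝ ∞ (fun p : ℂ × ℂ => ξ p.1) (D ×ˢ Set.univ) :=
    (contDiffOn_real_of_holomorphic hD hξ).comp contDiffOn_fst fun p hp => hp.1
  have hl : ContDiffOn ℝ ∞ (fun p : ℂ × ℂ => lHat p.2) (D ×ˢ Set.univ) :=
    (contDiff_lHat.comp contDiff_snd).contDiffOn
  refine ⟨⟨contDiffOn_mink h hl, fun p => mink (inversionVec (ξ p.1)) (lHat p.2),
    contDiffOn_mink (contDiff_inversionVec.comp_contDiffOn h) hl, fun τ _ w hw => ?_⟩,
    fun ζ τ hτ => (hasDerivAt_mink_worldLine hD hξ hτ _).differentiableAt.differentiableWithinAt⟩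
  simp only [zpow_zero, one_mul, mink_lHat_inv _ hw]

variable {U : Set ℝ} {T : ℝ → ℂ → ℂ}

/-- A regular variable takes values in `D` at `ζ = ∞` too, so functions on `D` may be composed
with its extension. -/
theorem IsRegularVariable.exists_extension (hT : IsRegularVariable U D T) :
    ∃ g : ℝ × ℂ → ℂ, ContDiffOn ℝ ∞ g (U ×ˢ Set.univ) ∧
      (∀ u ∈ U, ∀ w : ℂ, w ≠ 0 → g (u, w) = T u w⁻¹) ∧ ∀ p ∈ U ×ˢ Set.univ, g p ∈ D := by
  obtain ⟨-, g, hg, hgT⟩ := hT.regular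
  have hgT' : ∀ u ∈ U, ∀ w : ℂ, w ≠ 0 → g (u, w) = T u w⁻¹ := fun u hu w hw => by
    rw [hgT u hu w hw, zpow_zero, one_mul]
  refine ⟨g, hg, hgT', ?_⟩
  rintro ⟨u, w⟩ ⟨hu, -⟩
  by_cases hw : w = 0
  · obtain ⟨τ, hτ, hlim⟩ := hT.mem_infty u hu
    have hc : ContinuousOn (fun w => g (u, w)) Set.univ :=
      hg.continuousOn.comp (by fun_prop) fun w _ => ⟨hu, trivial⟩
    have h1 : Filter.Tendsto (fun w => g (u, w)) (nhdsWithin 0 {0}ᶜ) (nhds (g (u, 0))) :=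
      ((continuousOn_univ.1 hc).tendsto 0).mono_left nhdsWithin_le_nhds
    have h2 : Filter.Tendsto (fun w : ℂ => T u w⁻¹) (nhdsWithin 0 {0}ᶜ) (nhds τ) := by
      rw [← Metric.cobounded_eq_cocompact] at hlim
      exact hlim.comp Filter.tendsto_inv₀_nhdsNE_zero
    have h3 : Filter.Tendsto (fun w => g (u, w)) (nhdsWithin 0 {0}ᶜ) (nhds τ) := by
      refine h2.congr' ?_
      filter_upwards [self_mem_nhdsWithin] with w hw
      exact (hgT' u hu w hw).symm
    rw [hw, tendsto_nhds_unique h1 h3]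
    exact hτ
  · rw [hgT' u hu w hw]
    exact hT.mem u hu _

theorem isRegularFamily_angle (hD : IsOpen D) (hξ : DifferentiableOn ℂ ξ D)
    (hT : IsRegularVariable U D T) :
    IsRegularFamily 1 U (fun u ζ => mink (ξ (T u ζ)) (mHat ζ)) := by
  obtain ⟨g, hg, hgT, hgD⟩ := hT.exists_extension
  have hξ' := contDiffOn_real_of_holomorphic hD hξ
  have hm : ContDiffOn ℝ ∞ (fun p : ℝ × ℂ => mHat p.2) (U ×ˢ Set.univ) :=
    (contDiff_mHat.comp contDiff_snd).contDiffOn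
  refine ⟨contDiffOn_mink (hξ'.comp hT.regular.1 fun p hp => hT.mem p.1 hp.1 p.2) hm,
    fun p => mink (inversionVec (ξ (g p))) (mHat p.2),
    contDiffOn_mink (contDiff_inversionVec.comp_contDiffOn (hξ'.comp hg hgD)) hm,
    fun u hu w hw => ?_⟩
  simp only [zpow_one, mink_mHat_inv _ hw, hgT u hu w hw]

theorem worldLine_solution {O : Set (ℝ × ℂ)} (hO : IsOpen O) (hD : IsOpen D)
    (hξ : DifferentiableOn ℂ ξ D) (hT : ContDiffOn ℝ ∞ (fun p : ℝ × ℂ => T p.1 p.2) O)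
    (hTD : ∀ (u : ℝ) (ζ : ℂ), (u, ζ) ∈ O → T u ζ ∈ D)
    (hu : ∀ (u : ℝ) (ζ : ℂ), (u, ζ) ∈ O → (u : ℂ) = mink (ξ (T u ζ)) (lHat ζ)) :
    CREquation O (fun u ζ => mink (ξ (T u ζ)) (mHat ζ)) T ∧
      ShearFreeCondition O (fun u ζ => mink (ξ (T u ζ)) (mHat ζ)) := by
  have hG := (isRegularCutFunction_worldLine hD hξ).isHolomorphicFamily
  have hinv := fun u ζ hp => (hu u ζ hp).symm
  have hCR : CREquation O (fun u ζ => mink (ξ (T u ζ)) (mHat ζ)) T := fun u ζ hp =>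
    (cr_iff_eq_eth hO hD hG hT hTD hinv hp _).2 (eth_mink_lHat _ ζ).symm
  refine ⟨hCR, fun u ζ hp => ?_⟩
  rw [shearExpr_eq_eth_eth hO hD hG hT hTD (fun u ζ _ => (eth_mink_lHat _ ζ).symm) hCR hp,
    funext (eth_mink_lHat (ξ (T u ζ)))]
  exact eth_mink_mHat _ ζ

end WorldLine

/-- A regular cut function solving the good-cut equation is given by a holomorphic world line. -/
theorem IsRegularCutFunction.exists_worldLine {D : Set ℂ} {G : ℂ → ℂ → ℂ}
    (hG : IsRegularCutFunction D G) (h : GoodCutEquation D G) :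
    ∃ ξ : ℂ → Fin 4 → ℂ, DifferentiableOn ℂ ξ D ∧
      ∀ τ ∈ D, ∀ ζ : ℂ, G τ ζ = mink (ξ τ) (lHat ζ) := by
  refine ⟨fun τ => vecOfValues (G τ), ?_, fun τ hτ => ?_⟩
  · have hol := hG.holomorphic
    have h0 := hol 0
    have h1 := hol 1
    have h2 := hol (-1)
    have h3 := hol Complex.I
    refine differentiableOn_pi.2 fun i => ?_
    fin_cases i <;> simp [vecOfValues] <;> fun_prop
  · obtain ⟨hs, g, hg, hgG⟩ := hG.regular
    have hreg : IsRegularOnSphere 0 (G τ) := by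
      refine ⟨?_, fun w => g (τ, w), ?_, fun w hw => hgG τ hτ w hw⟩
      · exact contDiffOn_univ.1
          (hs.comp (f := fun ζ : ℂ => (τ, ζ)) (contDiff_prodMk_right τ).contDiffOn
            fun ζ _ => ⟨hτ, trivial⟩)
      · exact contDiffOn_univ.1
          (hg.comp (f := fun ζ : ℂ => (τ, ζ)) (contDiff_prodMk_right τ).contDiffOn
            fun ζ _ => ⟨hτ, trivial⟩)
    obtain ⟨z, hz⟩ := hreg.exists_eq_mink_lHat (h τ hτ)
    intro ζ
    simp only [show vecOfValues (G τ) = z by rw [funext hz, vecOfValues_mink_lHat], hz]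

/-- Implicit function theorem for `G(τ, ζ) = u`, through the inverse of `(τ, ζ) ↦ (G(τ, ζ), ζ)`. -/
theorem IsHolomorphicFamily.exists_implicit {D : Set ℂ} {G : ℂ → ℂ → ℂ}
    (hG : IsHolomorphicFamily D G) (hD : IsOpen D) {τ₀ ζ₀ : ℂ} {u₀ : ℝ} (hτ₀ : τ₀ ∈ D)
    (hu₀ : G τ₀ ζ₀ = u₀) (hne : deriv (fun τ => G τ ζ₀) τ₀ ≠ 0) :
    ∃ (O : Set (ℝ × ℂ)) (T : ℝ → ℂ → ℂ), IsOpen O ∧ (u₀, ζ₀) ∈ O ∧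
      ContDiffOn ℝ ∞ (fun p : ℝ × ℂ => T p.1 p.2) O ∧ T u₀ ζ₀ = τ₀ ∧
      ∀ (u : ℝ) (ζ : ℂ), (u, ζ) ∈ O → T u ζ ∈ D ∧ G (T u ζ) ζ = u := by
  let Φ : ℂ × ℂ → ℂ × ℂ := fun q => (G q.1 q.2, q.2)
  let W : Set (ℂ × ℂ) :=
    (D ×ˢ Set.univ) ∩ (fun q => fderiv ℝ (fun p : ℂ × ℂ => G p.1 p.2) q (1, 0)) ⁻¹' {0}ᶜ
  have hW : IsOpen W :=
    (((hG.contDiffOn_fderiv hD).clm_apply contDiffOn_const).continuousOn).isOpen_inter_preimage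
      (hD.prod isOpen_univ) isOpen_compl_singleton
  have hΦ : ∀ q ∈ W, ContDiffAt ℝ ∞ Φ q := fun q hq =>
    (hG.contDiffAt hD hq.1.1 q.2).prodMk contDiffAt_snd
  have hequiv : ∀ q ∈ W, ∃ e : (ℂ × ℂ) ≃L[ℝ] ℂ × ℂ, HasFDerivAt Φ (e : ℂ × ℂ →L[ℝ] ℂ × ℂ) q := by
    intro q hq
    have hd : HasFDerivAt Φ _ q :=
      (hG.differentiableAt hD hq.1.1 q.2).hasFDerivAt.prodMk hasFDerivAt_snd
    set A := (fderiv ℝ (fun p : ℂ × ℂ => G p.1 p.2) (q.1, q.2)).prod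
      (ContinuousLinearMap.snd ℝ ℂ ℂ)
    have hinj : Function.Injective (A : ℂ × ℂ →ₗ[ℝ] ℂ × ℂ) := by
      refine (injective_iff_map_eq_zero _).2 fun x hx => ?_
      have h2 : x.2 = 0 := congrArg Prod.snd hx
      have h1 : fderiv ℝ (fun p : ℂ × ℂ => G p.1 p.2) (q.1, q.2) x = 0 := congrArg Prod.fst hx
      have hq2 : fderiv ℝ (fun p : ℂ × ℂ => G p.1 p.2) (q.1, q.2) (1, 0) ≠ 0 := hq.2
      rw [show x = (x.1, 0) from Prod.ext rfl h2, hG.fderiv_left hD hq.1.1] at h1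
      rw [hG.fderiv_left hD hq.1.1, mul_one] at hq2
      exact Prod.ext ((mul_eq_zero.1 h1).resolve_left hq2) h2
    refine ⟨(LinearEquiv.ofInjectiveEndo _ hinj).toContinuousLinearEquiv, ?_⟩
    rwa [show ((LinearEquiv.ofInjectiveEndo (A : ℂ × ℂ →ₗ[ℝ] ℂ × ℂ)
      hinj).toContinuousLinearEquiv : ℂ × ℂ →L[ℝ] ℂ × ℂ) = A from rfl]
  have hmem : (τ₀, ζ₀) ∈ W := by
    refine ⟨⟨hτ₀, trivial⟩, ?_⟩
    change fderiv ℝ (fun p : ℂ × ℂ => G p.1 p.2) (τ₀, ζ₀) (1, 0) ≠ 0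
    rwa [hG.fderiv_left hD hτ₀, mul_one]
  obtain ⟨e₀, he₀⟩ := hequiv _ hmem
  let e := (hΦ _ hmem).toOpenPartialHomeomorph Φ he₀ (by simp)
  have he : ∀ q, e q = Φ q := fun q => rfl
  have hsrc : (τ₀, ζ₀) ∈ e.source :=
    (hΦ _ hmem).mem_toOpenPartialHomeomorph_source he₀ (by simp)
  have hΦ₀ : Φ (τ₀, ζ₀) = ((u₀ : ℂ), ζ₀) := by simp only [Φ, hu₀]
  have hsymm₀ : e.symm ((u₀ : ℂ), ζ₀) = (τ₀, ζ₀) := by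
    rw [← hΦ₀]
    exact e.left_inv hsrc
  let ι : ℝ × ℂ → ℂ × ℂ := fun p => ((p.1 : ℂ), p.2)
  have hι : ContDiff ℝ ∞ ι := (Complex.ofRealCLM.contDiff.comp contDiff_fst).prodMk contDiff_snd
  have hsnd : ∀ p, ι p ∈ e.target → Φ (e.symm (ι p)) = ι p := fun p hp => e.right_inv hp
  refine ⟨ι ⁻¹' (e.target ∩ e.symm ⁻¹' W), fun u ζ => (e.symm ((u : ℂ), ζ)).1,
    (e.isOpen_inter_preimage_symm hW).preimage hι.continuous, ⟨?_, ?_⟩, ?_, ?_, ?_⟩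
  · change ((u₀ : ℂ), ζ₀) ∈ e.target
    rw [← hΦ₀]
    exact e.map_source hsrc
  · change e.symm ((u₀ : ℂ), ζ₀) ∈ W
    rwa [hsymm₀]
  · intro p hp
    obtain ⟨e', he'⟩ := hequiv _ hp.2
    have h1 : ContDiffAt ℝ ∞ e.symm (ι p) := e.contDiffAt_symm hp.1 he' (hΦ _ hp.2)
    exact (contDiffAt_fst.comp p (h1.comp p hι.contDiffAt)).contDiffWithinAt
  · change (e.symm ((u₀ : ℂ), ζ₀)).1 = τ₀
    rw [hsymm₀]
  · intro u ζ hp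
    have h := hsnd (u, ζ) hp.1
    have h1 : G (e.symm ((u : ℂ), ζ)).1 (e.symm ((u : ℂ), ζ)).2 = u := congrArg Prod.fst h
    have h2 : (e.symm ((u : ℂ), ζ)).2 = ζ := congrArg Prod.snd h
    refine ⟨hp.2.1.1, ?_⟩
    rwa [h2] at h1

end ShearFree

/-! ### Shear-free congruences and complex world lines -/

theorem mainTheorem1 :
    -- The congruence is shear-free exactly when `ðL + L L̇ = 0`.
    (∀ (O : Set (ℝ × ℂ)) (L : ℝ → ℂ → ℂ) (r₀ : ℝ → ℂ → ℝ), IsOpen O →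
      ContDiffOn ℝ ∞ (fun p : ℝ × ℂ => L p.1 p.2) O →
      ContDiffOn ℝ ∞ (fun p : ℝ × ℂ => r₀ p.1 p.2) O →
      (ShearFree.IsShearFreeCongruence O L r₀ ↔ ShearFree.ShearFreeCondition O L)) ∧
    -- The shear-free condition becomes the homogeneous good-cut equation.
    (∀ (U : Set ℝ) (D : Set ℂ) (L T : ℝ → ℂ → ℂ) (G : ℂ → ℂ → ℂ),
      IsOpen U → U.Nonempty → IsOpen D → IsConnected D →
      ShearFree.IsRegularFamily 1 U L → ShearFree.IsCutChange U D L T G →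
      (∀ u ∈ U, ∀ ζ : ℂ, L u ζ = ShearFree.eth 0 (G (T u ζ)) ζ ∧
        ShearFree.shearExpr L u ζ = ShearFree.eth 1 (ShearFree.eth 0 (G (T u ζ))) ζ) ∧
      (ShearFree.ShearFreeCondition (U ×ˢ Set.univ) L ↔ ShearFree.GoodCutEquation D G)) ∧
    -- The regular solutions of the good-cut equation contain only `l = 0, 1` harmonics.
    (∀ g : ℂ → ℂ,
      (ShearFree.IsRegularOnSphere 0 g ∧ ∀ ζ : ℂ, ShearFree.eth 1 (ShearFree.eth 0 g) ζ = 0) ↔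
      ∃! z : Fin 4 → ℂ, ∀ ζ : ℂ, g ζ = (Real.sqrt 2 : ℂ) / 2 * z 0 * ShearFree.Y0 ζ
        - 1 / 2 * ∑ i : Fin 3, z i.succ * ShearFree.Y1 i ζ) ∧
    (∀ (z : Fin 4 → ℂ) (ζ : ℂ), ShearFree.mink z (ShearFree.lHat ζ) =
      (Real.sqrt 2 : ℂ) / 2 * z 0 * ShearFree.Y0 ζ
        - 1 / 2 * ∑ i : Fin 3, z i.succ * ShearFree.Y1 i ζ) ∧
    -- Regular shear-free congruences: the angle field is given parametrically by a world line.
    (∀ (U : Set ℝ) (D : Set ℂ) (L T : ℝ → ℂ → ℂ) (G : ℂ → ℂ → ℂ) (r₀ : ℝ → ℂ → ℝ),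
      IsOpen U → U.Nonempty → IsOpen D → IsConnected D →
      ContDiffOn ℝ ∞ (fun p : ℝ × ℂ => r₀ p.1 p.2) (U ×ˢ Set.univ) →
      ShearFree.IsRegularFamily 1 U L → ShearFree.IsCutChange U D L T G →
      ShearFree.IsShearFreeCongruence (U ×ˢ Set.univ) L r₀ →
      ∃ ξ : ℂ → Fin 4 → ℂ, DifferentiableOn ℂ ξ D ∧
        (∀ τ ∈ D, ∀ ζ : ℂ, G τ ζ = ShearFree.mink (ξ τ) (ShearFree.lHat ζ)) ∧
        ∀ u ∈ U, ∀ ζ : ℂ, (u : ℂ) = ShearFree.mink (ξ (T u ζ)) (ShearFree.lHat ζ) ∧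
          L u ζ = ShearFree.mink (ξ (T u ζ)) (ShearFree.mHat ζ)) ∧
    -- The world line is arbitrary: every one whose parameter can be regularly solved for gives a
    -- regular shear-free congruence,
    (∀ (U : Set ℝ) (D : Set ℂ) (ξ : ℂ → Fin 4 → ℂ) (T : ℝ → ℂ → ℂ) (r₀ : ℝ → ℂ → ℝ),
      IsOpen U → IsOpen D → DifferentiableOn ℂ ξ D →
      ContDiffOn ℝ ∞ (fun p : ℝ × ℂ => r₀ p.1 p.2) (U ×ˢ Set.univ) →
      ShearFree.IsRegularVariable U D T →
      (∀ u ∈ U, ∀ ζ : ℂ, (u : ℂ) = ShearFree.mink (ξ (T u ζ)) (ShearFree.lHat ζ)) →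
      let L : ℝ → ℂ → ℂ := fun u ζ => ShearFree.mink (ξ (T u ζ)) (ShearFree.mHat ζ)
      let G : ℂ → ℂ → ℂ := fun τ ζ => ShearFree.mink (ξ τ) (ShearFree.lHat ζ)
      ShearFree.IsRegularFamily 1 U L ∧ ShearFree.IsCutChange U D L T G ∧
        ShearFree.ShearFreeCondition (U ×ˢ Set.univ) L ∧
        ShearFree.IsShearFreeCongruence (U ×ˢ Set.univ) L r₀) ∧
    -- and every one can be solved for its parameter near any point where `ξ'^a l̂_a ≠ 0`.
    (∀ (D : Set ℂ) (ξ : ℂ → Fin 4 → ℂ) (τ₀ ζ₀ : ℂ) (u₀ : ℝ),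
      IsOpen D → DifferentiableOn ℂ ξ D → τ₀ ∈ D →
      (u₀ : ℂ) = ShearFree.mink (ξ τ₀) (ShearFree.lHat ζ₀) →
      ShearFree.mink (deriv ξ τ₀) (ShearFree.lHat ζ₀) ≠ 0 →
      ∃ (O : Set (ℝ × ℂ)) (T : ℝ → ℂ → ℂ), IsOpen O ∧ (u₀, ζ₀) ∈ O ∧
        ContDiffOn ℝ ∞ (fun p : ℝ × ℂ => T p.1 p.2) O ∧ T u₀ ζ₀ = τ₀ ∧
        (∀ (u : ℝ) (ζ : ℂ), (u, ζ) ∈ O →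
          T u ζ ∈ D ∧ (u : ℂ) = ShearFree.mink (ξ (T u ζ)) (ShearFree.lHat ζ)) ∧
        ShearFree.CREquation O
          (fun u ζ => ShearFree.mink (ξ (T u ζ)) (ShearFree.mHat ζ)) T ∧
        ShearFree.ShearFreeCondition O
          (fun u ζ => ShearFree.mink (ξ (T u ζ)) (ShearFree.mHat ζ))) := by
  refine ⟨fun O L r₀ hO hL hr => ShearFree.isShearFreeCongruence_iff hO hL hr,
    fun U D L T G hU hne hD hDc _ h =>
      ⟨fun u hu ζ => ⟨h.eq_eth hU hD hu ζ, h.shearExpr_eq hU hD hu ζ⟩,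
        h.shearFreeCondition_iff hU hne hD hDc⟩,
    fun g => ?_, ShearFree.mink_lHat_eq_harmonics, ?_, ?_, ?_⟩
  · simp only [← ShearFree.mink_lHat_eq_harmonics]
    exact ShearFree.regular_goodCut_iff_existsUnique g
  · intro U D L T G r₀ hU hne hD hDc hr hL h hS
    have hG := (h.shearFreeCondition_iff hU hne hD hDc).1
      ((ShearFree.isShearFreeCongruence_iff (hU.prod isOpen_univ) hL.1 hr).1 hS)
    obtain ⟨ξ, hξ, hGξ⟩ := h.cut_regular.exists_worldLine hG
    refine ⟨ξ, hξ, hGξ, fun u hu ζ => ?_⟩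
    have hτ := h.variable_regular.mem u hu ζ
    refine ⟨by rw [← hGξ _ hτ, h.inversion u hu ζ], ?_⟩
    rw [h.eq_eth hU hD hu ζ, funext (hGξ _ hτ), ShearFree.eth_mink_lHat]
  · intro U D ξ T r₀ hU hD hξ hr hT hu L G
    have hL : ShearFree.IsRegularFamily 1 U L := ShearFree.isRegularFamily_angle hD hξ hT
    have hsol := ShearFree.worldLine_solution (hU.prod isOpen_univ) hD hξ hT.regular.1
      (fun u ζ hp => hT.mem u hp.1 ζ) (fun u ζ hp => hu u hp.1 ζ)
    exact ⟨hL, ⟨hT, hsol.1, ShearFree.isRegularCutFunction_worldLine hD hξ,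
      fun u hu' ζ => (hu u hu' ζ).symm⟩, hsol.2,
      (ShearFree.isShearFreeCongruence_iff (hU.prod isOpen_univ) hL.1 hr).2 hsol.2⟩
  · intro D ξ τ₀ ζ₀ u₀ hD hξ hτ₀ hu₀ hne
    obtain ⟨O, T, hO, hmem, hT, hT₀, hTO⟩ :=
      (ShearFree.isRegularCutFunction_worldLine hD hξ).isHolomorphicFamily.exists_implicit hD hτ₀
        hu₀.symm (by rwa [(ShearFree.hasDerivAt_mink_worldLine hD hξ hτ₀ _).deriv])
    have hsol := ShearFree.worldLine_solution hO hD hξ hT (fun u ζ hp => (hTO u ζ hp).1)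
      (fun u ζ hp => (hTO u ζ hp).2.symm)
    exact ⟨O, T, hO, hmem, hT, hT₀, fun u ζ hp => ⟨(hTO u ζ hp).1, (hTO u ζ hp).2.symm⟩, hsol⟩
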